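/- Let $\alpha\in(0,2]$. For $2\pi$-periodic functions on $\mathbb T=\mathbb R/2\pi\mathbb Z$ let $D^{\alpha}$ be the Fourier multiplier with symbol $|k|^{\alpha}$, let $\Pi_0 f=f-\frac1{2\pi}\int_{-\pi}^{\pi}f\,dx$, and let $X_0=\{f\in L^2_{per}(\mathbb T):\int_{-\pi}^{\pi}f\,dx=0\}$. An even wave of speed $c$ is a smooth, real, even, $2\pi$-periodic function $\phi$ with zero mean satisfying $$cD^{\alpha}\phi+(c-1)\phi=\tfrac12\,\Pi_0\phi^2 .$$ For such $\phi$ put $\mathcal L=cD^{\alpha}+c-1-\phi$, $\mathcal L|_{X_0}=\mathcal L+\frac1{2\pi}\langle\phi,\cdot\rangle$ and $J=(1+D^{\alpha})^{-1}\partial_x$. The operator $J\mathcal L|_{X_0}$ is considered in $X_0$ as the closed operator whose domain consists of all $u\in X_0$ with $J\mathcal L|_{X_0}u\in X_0$ in the sense of distributions. The wave $\phi$ is called spectrally stable if $\sigma(J\mathcal L|_{X_0})\subset i\mathbb R$. There are $a_0>0$ and a family $(\phi_a,c_a)$, $a\in(0,a_0)$, where $\phi_a$ is an even wave of speed $c_a>\frac12$,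 such that $$\phi_a(x)=a\cos x+\frac{a^2}{2(2^{\alpha}-1)}\cos(2x)+O(a^3)\ \text{ uniformly in }x,\qquad c_a=\frac12+\frac{a^2}{8(2^{\alpha}-1)}+O(a^4),$$ such that, for some $\varepsilon>0$, every even wave $\psi\not\equiv0$ of speed $c'$ with $\|\psi\|_\infty<\varepsilon$ and $|c'-\frac12|<\varepsilon$ is, for some $a\in(0,a_0)$ with $c'=c_a$, equal to $\phi_a$ or to $\phi_a(\cdot+\pi)$, and such that $\phi_a$ is spectrally stable for every $a\in(0,a_0)$. -/

import Mathlib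

open MeasureTheory Set
open scoped ContDiff Real

noncomputable section

namespace FBBM

instance fact_two_pi_pos : Fact (0 < 2 * π) := ⟨Real.two_pi_pos⟩

/-- The circle `ℝ / 2πℤ`; functions on it are the `2π`-periodic functions. -/
abbrev Circ : Type := AddCircle (2 * π)

/-- `L²_per`. The measure is `dx / (2π)`, so that `fourierCoeff f k` is
`(1 / 2π) ∫_{-π}^{π} f(x) e^{-ikx} dx` and `fourier k` is `e^{ikx}`. -/
abbrev L2per : Type := Lp ℂ 2 (AddCircle.haarAddCircle : Measure Circ)

/-! ### Travelling waves -/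

/-- Fourier symbol `|k|^α` of `D^α`. -/
def absPow (α : ℝ) (k : ℤ) : ℝ := |(k : ℝ)| ^ α

/-- The projection `Π₀ f = f - (1 / 2π) ∫_{-π}^{π} f` onto mean zero functions. -/
def proj0 (f : Circ → ℝ) (x : Circ) : ℝ :=
  f x - (1 / (2 * π)) * ∫ y in (-π)..π, f (y : Circ)

/-- `φ` is a smooth, even, mean zero, `2π`-periodic solution of
`c D^α φ + (c - 1) φ = (1/2) Π₀ φ²`. The equation is an equality of two continuous functions and
is written as the equality of all their Fourier coefficients, `D^α` being the Fourier
multiplier `|k|^α`. -/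
structure IsEvenWave (α c : ℝ) (φ : C(Circ, ℝ)) : Prop where
  smooth : ContDiff ℝ ∞ (fun x : ℝ => φ (x : Circ))
  even : ∀ x : Circ, φ (-x) = φ x
  mean_zero : ∫ x in (-π)..π, φ (x : Circ) = 0
  equation : ∀ k : ℤ,
    ((c * absPow α k + (c - 1) : ℝ) : ℂ) * fourierCoeff (fun x : Circ => (φ x : ℂ)) k
      = (1 / 2) * fourierCoeff (fun x : Circ => ((proj0 (fun y => φ y ^ 2) x : ℝ) : ℂ)) k

/-- The small amplitude waves: a family `(φ_a, c_a)`, `0 < a < a₀`, of even waves with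
`φ_a = a cos x + a² cos (2x) / (2 (2^α - 1)) + O(a³)` uniformly in `x`,
`c_a = 1/2 + a² / (8 (2^α - 1)) + O(a⁴)` and `c_a > 1/2`, which contains, up to the translation
by half a period, every nontrivial even wave near the bifurcation point `(φ, c) = (0, 1/2)`. -/
structure IsSmallAmplitudeBranch (α a₀ : ℝ) (φ : ℝ → C(Circ, ℝ)) (c : ℝ → ℝ) : Prop where
  wave : ∀ a ∈ Ioo 0 a₀, IsEvenWave α (c a) (φ a)
  speed_gt : ∀ a ∈ Ioo 0 a₀, 1 / 2 < c a
  profile : ∃ K : ℝ, ∀ a ∈ Ioo 0 a₀, ∀ x : ℝ,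
    |φ a (x : Circ) - (a * Real.cos x + a ^ 2 / (2 * (2 ^ α - 1)) * Real.cos (2 * x))|
      ≤ K * a ^ 3
  speed : ∃ K : ℝ, ∀ a ∈ Ioo 0 a₀,
    |c a - (1 / 2 + a ^ 2 / (8 * (2 ^ α - 1)))| ≤ K * a ^ 4
  locally_unique : ∃ ε > 0, ∀ (c' : ℝ) (ψ : C(Circ, ℝ)), IsEvenWave α c' ψ → ψ ≠ 0 →
    ‖ψ‖ < ε → |c' - 1 / 2| < ε →
    ∃ a ∈ Ioo 0 a₀, c' = c a ∧
      ((∀ x : Circ, ψ x = φ a x) ∨ (∀ x : Circ, ψ x = φ a (x + ((π : ℝ) : Circ))))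

/-! ### The space `X₀` and the linearized operator -/

lemma integrable_L2per (u : L2per) : Integrable u AddCircle.haarAddCircle :=
  (Lp.memLp u).integrable (by norm_num)

/-- The closed subspace `X₀` of mean zero functions in `L²_per`. -/
def X0 : Submodule ℂ L2per where
  carrier := {u | ∫ x, u x ∂AddCircle.haarAddCircle = 0}
  zero_mem' := by
    simp only [mem_ofPred_eq]
    rw [integral_congr_ae (Lp.coeFn_zero ℂ 2 (AddCircle.haarAddCircle : Measure Circ))]
    simp
  add_mem' := by
    intro u v hu hv
    simp only [mem_ofPred_eq] at hu hv ⊢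
    rw [integral_congr_ae (Lp.coeFn_add u v)]
    simp only [Pi.add_apply]
    rw [integral_add (integrable_L2per u) (integrable_L2per v), hu, hv, add_zero]
  smul_mem' := by
    intro s u hu
    simp only [mem_ofPred_eq] at hu ⊢
    rw [integral_congr_ae (Lp.coeFn_smul s u)]
    simp only [Pi.smul_apply]
    rw [integral_smul, hu, smul_zero]

/-- The pointwise product `φ u`. -/
def mulFun (φ : C(Circ, ℝ)) (u : L2per) (x : Circ) : ℂ := (φ x : ℂ) * u x

/-- `k`-th Fourier coefficient of the distribution
`ℒ|_{X₀} u = c D^α u + (c - 1) u - φ u + (1 / 2π) ⟨φ, u⟩`. -/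
def linCoeff (α c : ℝ) (φ : C(Circ, ℝ)) (u : L2per) (k : ℤ) : ℂ :=
  ((c * absPow α k + (c - 1) : ℝ) : ℂ) * fourierCoeff u k - fourierCoeff (mulFun φ u) k
    + (if k = 0 then ∫ x, mulFun φ u x ∂AddCircle.haarAddCircle else 0)

lemma integrable_mulFun (φ : C(Circ, ℝ)) (u : L2per) :
    Integrable (mulFun φ u) AddCircle.haarAddCircle := by
  refine (integrable_L2per u).bdd_mul (c := ‖φ‖) ?_ ?_
  · exact (Complex.continuous_ofReal.comp φ.continuous).aestronglyMeasurable
  · exact Filter.Eventually.of_forall fun x => by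
      simpa using φ.norm_coe_le_norm x

lemma linCoeff_add (α c : ℝ) (φ : C(Circ, ℝ)) (u v : L2per) (k : ℤ) :
    linCoeff α c φ (u + v) k = linCoeff α c φ u k + linCoeff α c φ v k := by
  have h : mulFun φ (u + v) =ᵐ[AddCircle.haarAddCircle] mulFun φ u + mulFun φ v := by
    filter_upwards [Lp.coeFn_add u v] with x hx
    simp only [mulFun, hx, Pi.add_apply, mul_add]
  have h2 : ∫ x, mulFun φ (u + v) x ∂AddCircle.haarAddCircle
      = ∫ x, mulFun φ u x ∂AddCircle.haarAddCircle
        + ∫ x, mulFun φ v x ∂AddCircle.haarAddCircle := by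
    rw [integral_congr_ae h, ← integral_add (integrable_mulFun φ u) (integrable_mulFun φ v)]
    rfl
  have h3 : fourierCoeff (mulFun φ (u + v)) k
      = fourierCoeff (mulFun φ u) k + fourierCoeff (mulFun φ v) k := by
    rw [fourierCoeff_congr_ae h,
      fourierCoeff.add (integrable_mulFun φ u) (integrable_mulFun φ v), Pi.add_apply]
  have h4 : fourierCoeff (u + v : L2per) k = fourierCoeff u k + fourierCoeff v k := by
    rw [fourierCoeff_congr_ae (Lp.coeFn_add u v),
      fourierCoeff.add (integrable_L2per u) (integrable_L2per v), Pi.add_apply]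
  unfold linCoeff
  rw [h2, h3, h4]
  split_ifs <;> ring

lemma linCoeff_smul (α c : ℝ) (φ : C(Circ, ℝ)) (s : ℂ) (u : L2per) (k : ℤ) :
    linCoeff α c φ (s • u) k = s * linCoeff α c φ u k := by
  have h : mulFun φ (s • u) =ᵐ[AddCircle.haarAddCircle] fun x => s * mulFun φ u x := by
    filter_upwards [Lp.coeFn_smul s u] with x hx
    simp only [mulFun, hx, Pi.smul_apply, smul_eq_mul]
    ring
  have h2 : ∫ x, mulFun φ (s • u) x ∂AddCircle.haarAddCircle
      = s * ∫ x, mulFun φ u x ∂AddCircle.haarAddCircle := by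
    rw [integral_congr_ae h, integral_const_mul]
  have h3 : fourierCoeff (mulFun φ (s • u)) k = s * fourierCoeff (mulFun φ u) k := by
    rw [fourierCoeff_congr_ae h, fourierCoeff.const_mul]
  have h4 : fourierCoeff (s • u : L2per) k = s * fourierCoeff u k := by
    rw [fourierCoeff_congr_ae (Lp.coeFn_smul s u)]
    exact fourierCoeff.const_mul _ s k
  unfold linCoeff
  rw [h2, h3, h4]
  split_ifs <;> ring

/-- The graph of `J ℒ|_{X₀}`, `J = (1 + D^α)⁻¹ ∂ₓ`, in `X₀ × X₀`: the pairs `(u, w)` with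
`(1 + D^α) w = ∂ₓ (ℒ|_{X₀} u)` in the sense of periodic distributions, that is, with equality of
all Fourier coefficients. -/
def graphJL (α c : ℝ) (φ : C(Circ, ℝ)) : Submodule ℂ (X0 × X0) where
  carrier := {p | ∀ k : ℤ, ((1 + absPow α k : ℝ) : ℂ) * fourierCoeff (p.2 : L2per) k
      = Complex.I * k * linCoeff α c φ (p.1 : L2per) k}
  zero_mem' := by
    intro k
    have h1 := linCoeff_smul α c φ 0 0 k
    have h2 : fourierCoeff (0 : L2per) k = 0 := by
      rw [fourierCoeff_congr_ae (Lp.coeFn_zero ℂ 2 (AddCircle.haarAddCircle : Measure Circ))]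
      simp [fourierCoeff]
    rw [zero_smul, zero_mul] at h1
    change _ * fourierCoeff (0 : L2per) k = _ * linCoeff α c φ 0 k
    rw [h1, h2, mul_zero, mul_zero]
  add_mem' := by
    intro p q hp hq k
    have h4 : fourierCoeff ((p.2 : L2per) + (q.2 : L2per) : L2per) k
        = fourierCoeff (p.2 : L2per) k + fourierCoeff (q.2 : L2per) k := by
      rw [fourierCoeff_congr_ae (Lp.coeFn_add _ _),
        fourierCoeff.add (integrable_L2per _) (integrable_L2per _), Pi.add_apply]
    simp only [Prod.fst_add, Prod.snd_add, Submodule.coe_add]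
    rw [h4, linCoeff_add, mul_add, mul_add, hp k, hq k]
  smul_mem' := by
    intro s p hp k
    have h4 : fourierCoeff (s • (p.2 : L2per) : L2per) k
        = s * fourierCoeff (p.2 : L2per) k := by
      rw [fourierCoeff_congr_ae (Lp.coeFn_smul s _)]
      exact fourierCoeff.const_mul _ s k
    simp only [Prod.smul_fst, Prod.smul_snd, Submodule.coe_smul]
    rw [h4, linCoeff_smul, mul_left_comm, hp k]
    ring

/-- The operator `J ℒ|_{X₀}` in `X₀` with its natural domain: all `u ∈ X₀` for which
`J ℒ|_{X₀} u`, computed in the sense of distributions, lies in `X₀`. It is closed. -/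
def opJL (α c : ℝ) (φ : C(Circ, ℝ)) : X0 →ₗ.[ℂ] X0 := (graphJL α c φ).toLinearPMap

/-- `graphJL` is the graph of a map, so `opJL` is the operator with this graph. -/
theorem mem_graph_opJL (α c : ℝ) (φ : C(Circ, ℝ)) (u w : X0) :
    (u, w) ∈ (opJL α c φ).graph ↔
      ∀ k : ℤ, ((1 + absPow α k : ℝ) : ℂ) * fourierCoeff (w : L2per) k
        = Complex.I * k * linCoeff α c φ (u : L2per) k := by
  have key : ∀ p ∈ graphJL α c φ, p.1 = 0 → p.2 = 0 := by
    intro p hp h0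
    have hz : ∀ k : ℤ, fourierCoeff (p.2 : L2per) k = 0 := by
      intro k
      have h1 := hp k
      have h2 := linCoeff_smul α c φ 0 0 k
      rw [zero_smul, zero_mul] at h2
      rw [h0, ZeroMemClass.coe_zero, h2, mul_zero] at h1
      rcases mul_eq_zero.1 h1 with h3 | h3
      · exfalso
        have h4 : (0 : ℝ) ≤ absPow α k := Real.rpow_nonneg (abs_nonneg _) _
        have h5 : (1 + absPow α k : ℝ) = 0 := by exact_mod_cast h3
        linarith
      · exact h3
    apply Subtype.ext
    apply (fourierBasis (T := 2 * π)).repr.injective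
    ext k
    rw [fourierBasis_repr, hz k]
    simp
  rw [opJL, Submodule.toLinearPMap_graph_eq _ key]
  rfl

/-! ### Spectrum and spectral stability -/

/-- The resolvent set of an unbounded operator `T`: those `μ` for which `T - μ` is a bijection from
the domain of `T` onto the whole space with a bounded inverse `R`. -/
def resolvent {E : Type*} [NormedAddCommGroup E] [NormedSpace ℂ E] (T : E →ₗ.[ℂ] E) : Set ℂ :=
  {μ | ∃ R : E →L[ℂ] E,
    (∀ f : E, ∃ h : R f ∈ T.domain, T ⟨R f, h⟩ - μ • R f = f) ∧
    (∀ u : T.domain, R (T u - μ • (u : E)) = u)}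

/-- The spectrum `σ(T)` of an unbounded operator. -/
def spec {E : Type*} [NormedAddCommGroup E] [NormedSpace ℂ E] (T : E →ₗ.[ℂ] E) : Set ℂ :=
  (resolvent T)ᶜ

/-- Spectral stability: `σ(J ℒ|_{X₀}) ⊆ iℝ`. -/
def SpectrallyStable (α c : ℝ) (φ : C(Circ, ℝ)) : Prop :=
  spec (opJL α c φ) ⊆ {μ : ℂ | μ.re = 0}

end FBBM

end

/-!
Everything is reduced to Fourier coefficients in `L²`. With `c = 1/2 + γ` the symbol
`c |k|^α + c - 1` is at least `κ (1 + |k|^α)` at the frequencies `|k| ≥ 2`, for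
`|γ| ≤ κ = gap α`, and it vanishes at `|k| = 1` for `γ = 0`. So a small even wave is dominated by
its frequency `1` (`IsEvenWave.high_le`), and this one estimate gives both the uniqueness and the
stability of small waves.

*Uniqueness* (`IsEvenWave.eq_of_coef_one_eq`). For two small waves with the same frequency `1`, the
equation at `k = 1` bounds the difference of the speeds by the `L²` distance of the waves, and the
equations at `|k| ≥ 2` then bound this distance by a fraction of itself. Only smallness in the
supremum norm enters, through `‖ψ² - φ²‖ ≤ ‖ψ + φ‖_∞ ‖ψ - φ‖` in `L²`. A wave whose frequency `1`
has a negative coefficient is translated by half a period.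

*Stability* (`IsEvenWave.spectrallyStable`). For `Re μ ≠ 0` the multiplier `c ∂ₓ - μ` is invertible
and `J ℒ - μ = (c ∂ₓ - μ) (1 - K)`, where `K u = (c ∂ₓ - μ)⁻¹ J (u + φ u)` is compact because the
symbol of `(c ∂ₓ - μ)⁻¹ J` decays like `|k|^{-α}`. By the Fredholm alternative it suffices to exclude
eigenfunctions `u` (`IsEvenWave.eigenfunction_eq_zero`). For these `⟨ℒ u, u⟩ = 0`, by the skewness of
`J`, and `⟨(1 + D^α) φ, u⟩ = 0`, because `(1 + D^α) φ` lies in the kernel of the adjoint. Let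
`y = u - b φ'`, with `b` such that `y` has equal coefficients at the frequencies `1` and `-1`. As
`ℒ φ' = 0`, also `⟨ℒ y, y⟩ = 0` and `⟨(1 + D^α) φ, y⟩ = 0`. Since `φ` is dominated by `cos`, the last
relation bounds the frequencies `±1` of `y` by its higher frequencies, on which `ℒ` is positive
definite. So `y = 0`, hence `ℒ u = 0` and `u = 0`.

*Existence* (`exists_wave`). Write `φ = a (cos + v)` with `v` supported on the frequencies
`|k| ≥ 2`. The equation at `k = 1` gives `γ` as a function of `v`, and the other equations become a
fixed point problem for `v`, contracting for small `a` in the Banach algebra of Fourier series with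
`∑ 2^{|k|} |v_k| < ∞`. The exponential weight makes the solutions smooth. The expansions are read
off from the fixed point equation.
-/

noncomputable section

namespace FBBM

/-! ### Fourier coefficients in `L²` -/

/-- A real continuous function regarded as an element of `L²_per`. -/
def ofC (φ : C(Circ, ℝ)) : L2per :=
  ContinuousMap.toLp (E := ℂ) 2 AddCircle.haarAddCircle ℂ
    ⟨fun x => (φ x : ℂ), Complex.continuous_ofReal.comp φ.continuous⟩

lemma coeFn_ofC (φ : C(Circ, ℝ)) :
    ofC φ =ᵐ[AddCircle.haarAddCircle] fun x => (φ x : ℂ) :=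
  ContinuousMap.coeFn_toLp _ _

lemma fourierCoeff_ofC (φ : C(Circ, ℝ)) :
    fourierCoeff (ofC φ) = fourierCoeff (fun x : Circ => (φ x : ℂ)) :=
  fourierCoeff_congr_ae (coeFn_ofC φ)

lemma ofC_sub (φ ψ : C(Circ, ℝ)) : ofC (φ - ψ) = ofC φ - ofC ψ := by
  rw [ofC, ofC, ofC, ← map_sub]
  congr 1
  ext x
  simp

lemma ofC_add (φ ψ : C(Circ, ℝ)) : ofC (φ + ψ) = ofC φ + ofC ψ := by
  rw [ofC, ofC, ofC, ← map_add]
  congr 1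
  ext x
  simp

lemma norm_ofC_le (φ : C(Circ, ℝ)) : ‖ofC φ‖ ≤ ‖φ‖ := by
  have h : ‖ofC φ‖ ≤ (measureUnivNNReal (AddCircle.haarAddCircle : Measure Circ) : ℝ) ^
      (ENNReal.toReal 2)⁻¹ * ‖φ‖ := by
    refine Lp.norm_le_of_ae_bound (norm_nonneg _) ?_
    filter_upwards [coeFn_ofC φ] with x hx
    rw [hx]
    simpa using φ.norm_coe_le_norm x
  simpa [measureUnivNNReal] using h

lemma fourierCoeff_add' (u v : L2per) (k : ℤ) :
    fourierCoeff (u + v : L2per) k = fourierCoeff u k + fourierCoeff v k := by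
  simp only [← fourierBasis_repr, map_add, lp.coeFn_add, Pi.add_apply]

lemma fourierCoeff_sub' (u v : L2per) (k : ℤ) :
    fourierCoeff (u - v : L2per) k = fourierCoeff u k - fourierCoeff v k := by
  simp only [← fourierBasis_repr, map_sub, lp.coeFn_sub, Pi.sub_apply]

lemma fourierCoeff_smul' (s : ℂ) (u : L2per) (k : ℤ) :
    fourierCoeff (s • u : L2per) k = s * fourierCoeff u k := by
  simp only [← fourierBasis_repr, map_smul, lp.coeFn_smul, Pi.smul_apply, smul_eq_mul]

lemma fourierCoeff_zero' (k : ℤ) : fourierCoeff (0 : L2per) k = 0 := by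
  simp only [← fourierBasis_repr, map_zero, lp.coeFn_zero, Pi.zero_apply]

lemma ext_fourierCoeff {u v : L2per} (h : ∀ k : ℤ, fourierCoeff u k = fourierCoeff v k) :
    u = v := by
  apply (fourierBasis (T := 2 * π)).repr.injective
  ext k
  rw [fourierBasis_repr, fourierBasis_repr, h k]

lemma hasSum_norm_sq (u : L2per) :
    HasSum (fun k : ℤ => ‖fourierCoeff u k‖ ^ 2) (‖u‖ ^ 2) := by
  have h := lp.hasSum_norm (p := 2) (by norm_num) ((fourierBasis (T := 2 * π)).repr u)
  simpa [fourierBasis_repr] using h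

lemma norm_fourierCoeff_le (u : L2per) (k : ℤ) : ‖fourierCoeff u k‖ ≤ ‖u‖ := by
  have h := le_hasSum (hasSum_norm_sq u) k (fun _ _ => by positivity)
  exact le_of_sq_le_sq h (norm_nonneg _)

lemma hasSum_inner (u v : L2per) :
    HasSum (fun k : ℤ => (starRingEnd ℂ) (fourierCoeff u k) * fourierCoeff v k) (inner ℂ u v) := by
  have h := (fourierBasis (T := 2 * π)).hasSum_inner_mul_inner u v
  refine h.congr_fun fun k => ?_
  rw [← fourierBasis_repr, ← fourierBasis_repr, HilbertBasis.repr_apply_apply,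
    HilbertBasis.repr_apply_apply, inner_conj_symm]

lemma memLp_mulFun (φ : C(Circ, ℝ)) (u : L2per) :
    MemLp (mulFun φ u) 2 AddCircle.haarAddCircle := by
  refine (Lp.memLp u).of_le_mul (c := ‖φ‖) (integrable_mulFun φ u).1
    (Filter.Eventually.of_forall fun x => ?_)
  rw [mulFun, norm_mul]
  gcongr
  simpa using φ.norm_coe_le_norm x

/-- Multiplication by a real continuous function, on `L²_per`. -/
def mulL2 (φ : C(Circ, ℝ)) : L2per →L[ℂ] L2per :=
  LinearMap.mkContinuous
    { toFun := fun u => (memLp_mulFun φ u).toLp _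
      map_add' := by
        intro u v
        rw [← MemLp.toLp_add]
        refine MemLp.toLp_congr _ _ ?_
        filter_upwards [Lp.coeFn_add u v] with x hx
        simp only [mulFun, hx, Pi.add_apply, mul_add]
      map_smul' := by
        intro s u
        rw [RingHom.id_apply, ← MemLp.toLp_const_smul]
        refine MemLp.toLp_congr _ _ ?_
        filter_upwards [Lp.coeFn_smul s u] with x hx
        simp only [mulFun, hx, Pi.smul_apply, smul_eq_mul]
        ring }
    ‖φ‖ (by
      intro u
      refine Lp.norm_le_mul_norm_of_ae_le_mul ?_
      filter_upwards [MemLp.coeFn_toLp (memLp_mulFun φ u)] with x hx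
      rw [LinearMap.coe_mk, AddHom.coe_mk, hx, mulFun, norm_mul]
      gcongr
      simpa using φ.norm_coe_le_norm x)

lemma coeFn_mulL2 (φ : C(Circ, ℝ)) (u : L2per) :
    mulL2 φ u =ᵐ[AddCircle.haarAddCircle] mulFun φ u :=
  MemLp.coeFn_toLp (memLp_mulFun φ u)

lemma fourierCoeff_mulFun (φ : C(Circ, ℝ)) (u : L2per) :
    fourierCoeff (mulFun φ u) = fourierCoeff (mulL2 φ u) :=
  fourierCoeff_congr_ae (coeFn_mulL2 φ u).symm

lemma norm_mulL2_le (φ : C(Circ, ℝ)) (u : L2per) : ‖mulL2 φ u‖ ≤ ‖φ‖ * ‖u‖ :=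
  LinearMap.mkContinuous_norm_le _ (norm_nonneg _) _ |> (mulL2 φ).le_of_opNorm_le <| u

lemma mulL2_ofC (φ ψ : C(Circ, ℝ)) : mulL2 φ (ofC ψ) = ofC (φ * ψ) := by
  apply Lp.ext
  filter_upwards [coeFn_mulL2 φ (ofC ψ), coeFn_ofC ψ, coeFn_ofC (φ * ψ)] with x h1 h2 h3
  rw [h1, h3, mulFun, h2]
  simp

lemma inner_mulL2 (φ : C(Circ, ℝ)) (u v : L2per) :
    inner ℂ (mulL2 φ u) v = inner ℂ u (mulL2 φ v) := by
  rw [L2.inner_def, L2.inner_def]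
  refine integral_congr_ae ?_
  filter_upwards [coeFn_mulL2 φ u, coeFn_mulL2 φ v] with x h1 h2
  rw [h1, h2, mulFun, mulFun]
  simp [mul_comm, mul_left_comm]

lemma fourierCoeff_zero_eq (f : Circ → ℂ) :
    fourierCoeff f 0 = ∫ x, f x ∂AddCircle.haarAddCircle := by
  simp [fourierCoeff]

lemma mem_X0_iff (u : L2per) : u ∈ X0 ↔ fourierCoeff u 0 = 0 := by
  rw [fourierCoeff_zero_eq]
  rfl

/-- The Fourier multiplier with bounded symbol `m`, on `L²_per`. -/
def diagL2 (m : ℤ → ℂ) {K : ℝ} (hK : 0 ≤ K) (hm : ∀ k, ‖m k‖ ≤ K) : L2per →L[ℂ] L2per :=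
  ((fourierBasis (T := 2 * π)).repr.symm.toContinuousLinearEquiv : _ →L[ℂ] L2per) ∘L
    (lp.mapCLM 2 (fun k => m k • ContinuousLinearMap.id ℂ ℂ) hK (fun k => by
      simpa [norm_smul] using hm k)) ∘L
    ((fourierBasis (T := 2 * π)).repr.toContinuousLinearEquiv : L2per →L[ℂ] _)

lemma fourierCoeff_diagL2 (m : ℤ → ℂ) {K : ℝ} (hK : 0 ≤ K) (hm : ∀ k, ‖m k‖ ≤ K) (u : L2per)
    (k : ℤ) : fourierCoeff (diagL2 m hK hm u) k = m k * fourierCoeff u k := by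
  rw [← fourierBasis_repr, ← fourierBasis_repr]
  simp [diagL2]

lemma norm_diagL2_le (m : ℤ → ℂ) {K : ℝ} (hK : 0 ≤ K) (hm : ∀ k, ‖m k‖ ≤ K) :
    ‖diagL2 m hK hm‖ ≤ K := by
  refine ContinuousLinearMap.opNorm_le_bound _ hK fun u => ?_
  refine le_of_sq_le_sq ?_ (by positivity)
  have h1 := hasSum_norm_sq (diagL2 m hK hm u)
  have h2 := (hasSum_norm_sq u).mul_left (K ^ 2)
  rw [mul_pow]
  refine hasSum_le (fun k => ?_) h1 h2
  rw [fourierCoeff_diagL2, norm_mul, mul_pow]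
  gcongr
  exact hm k

/-- A Fourier multiplier with finitely supported symbol has finite rank, and every symbol tending
to zero is a uniform limit of such symbols. -/
lemma isCompactOperator_diagL2 (m : ℤ → ℂ) {K : ℝ} (hK : 0 ≤ K) (hm : ∀ k, ‖m k‖ ≤ K)
    (hlim : Filter.Tendsto m Filter.cofinite (nhds 0)) :
    IsCompactOperator (diagL2 m hK hm) := by
  classical
  let t : Finset ℤ → ℤ → ℂ := fun s k => if k ∈ s then m k else 0
  have ht : ∀ s k, ‖t s k‖ ≤ K := by
    intro s k
    by_cases h : k ∈ s
    · simpa [t, h] using hm k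
    · simpa [t, h] using hK
  refine isCompactOperator_of_tendsto (l := Filter.atTop) (F := fun s => diagL2 (t s) hK (ht s))
    ?_ (Filter.Eventually.of_forall fun s => ?_)
  · rw [Metric.tendsto_atTop]
    intro ε hε
    have h1 : {k : ℤ | ¬ ‖m k‖ < ε / 2}.Finite := by
      have := hlim.eventually (Metric.ball_mem_nhds (0 : ℂ) (half_pos hε))
      simpa only [Filter.eventually_cofinite, Metric.mem_ball, dist_zero_right] using this
    refine ⟨h1.toFinset, fun s hs => ?_⟩
    have h2 : ∀ k, ‖t s k - m k‖ ≤ ε / 2 := by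
      intro k
      by_cases h : k ∈ s
      · simpa [t, h] using (half_pos hε).le
      · have h3 : ¬ k ∈ h1.toFinset := fun h4 => h (hs h4)
        simp only [Finite.mem_toFinset, mem_ofPred_eq, not_not] at h3
        simpa [t, h] using h3.le
    have h3 : diagL2 (t s) hK (ht s) - diagL2 m hK hm
        = diagL2 (fun k => t s k - m k) (half_pos hε).le h2 := by
      ext1 u
      apply ext_fourierCoeff
      intro k
      rw [sub_apply, fourierCoeff_sub', fourierCoeff_diagL2,
        fourierCoeff_diagL2, fourierCoeff_diagL2]
      ring
    rw [dist_eq_norm, h3]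
    exact (norm_diagL2_le _ _ _).trans_lt (half_lt_self hε)
  · have h1 : (diagL2 (t s) hK (ht s) : L2per → L2per)
        = fun u : L2per => ∑ k ∈ s, (m k * fourierCoeff u k) • fourierBasis (T := 2 * π) k := by
      funext u
      apply ext_fourierCoeff
      intro j
      rw [fourierCoeff_diagL2, ← fourierBasis_repr, ← fourierBasis_repr, map_sum, lp.coeFn_sum,
        Finset.sum_apply]
      simp only [map_smul, HilbertBasis.repr_self, lp.coeFn_smul, Pi.smul_apply, lp.single_apply,
        Pi.single_apply, smul_eq_mul, t]
      by_cases h : j ∈ s <;> simp [h, fourierBasis_repr]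
    let e : L2per →L[ℂ] (s → ℂ) := ContinuousLinearMap.pi fun k =>
      m k • ((lp.evalCLM ℂ (fun _ : ℤ => ℂ) 2 (k : ℤ)) ∘L
        ((fourierBasis (T := 2 * π)).repr.toContinuousLinearEquiv : L2per →L[ℂ] _))
    let g : (s → ℂ) →L[ℂ] L2per := ∑ k : s,
      (ContinuousLinearMap.proj (R := ℂ) (φ := fun _ : s => ℂ) k).smulRight
        (fourierBasis (T := 2 * π) k)
    have h2 : (diagL2 (t s) hK (ht s) : L2per → L2per) = g ∘ e := by
      rw [h1]
      funext u
      simp only [g, e, Function.comp, sum_apply]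
      rw [← Finset.sum_coe_sort]
      refine Finset.sum_congr rfl fun k _ => ?_
      simp [← fourierBasis_repr]
      rfl
    have h3 : IsCompactOperator (g : (s → ℂ) → L2per) :=
      isCompactOperator_of_locallyCompactSpace_rng g
    rw [h2]
    exact h3.comp_clm e

/-! ### The dispersion symbol -/

lemma absPow_one (α : ℝ) : absPow α 1 = 1 := by simp [absPow]

lemma absPow_neg (α : ℝ) (k : ℤ) : absPow α (-k) = absPow α k := by simp [absPow]

lemma absPow_nonneg (α : ℝ) (k : ℤ) : 0 ≤ absPow α k := Real.rpow_nonneg (abs_nonneg _) _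

lemma one_lt_two_rpow {α : ℝ} (hα : 0 < α) : (1 : ℝ) < 2 ^ α :=
  Real.one_lt_rpow (by norm_num) hα

lemma two_rpow_le_absPow {α : ℝ} (hα : 0 < α) {k : ℤ} (hk : 1 < |k|) : 2 ^ α ≤ absPow α k := by
  refine Real.rpow_le_rpow (by norm_num) ?_ hα.le
  have h : (2 : ℤ) ≤ |k| := hk
  exact_mod_cast h

/-- A constant `κ > 0` with `c |k|^α + c - 1 ≥ κ (1 + |k|^α)` for `|k| ≥ 2` and
`|c - 1/2| ≤ κ`. -/
def gap (α : ℝ) : ℝ := (2 ^ α - 1) / (4 * (2 ^ α + 1))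

lemma gap_pos {α : ℝ} (hα : 0 < α) : 0 < gap α := by
  have := one_lt_two_rpow hα
  unfold gap
  apply div_pos <;> linarith

lemma gap_lt {α : ℝ} (hα : 0 < α) : gap α < 1 / 4 := by
  have := one_lt_two_rpow hα
  unfold gap
  rw [div_lt_iff₀ (by linarith)]
  linarith

lemma gap_mul_le {α c : ℝ} (hα : 0 < α) (hc : |c - 1 / 2| ≤ gap α) {t : ℝ} (ht : 2 ^ α ≤ t) :
    gap α * (1 + t) ≤ c * t + (c - 1) := by
  have h1 := one_lt_two_rpow hα
  have h2 : gap α * (4 * (2 ^ α + 1)) = 2 ^ α - 1 := by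
    unfold gap
    field_simp
  have h3 := (abs_le.1 hc).1
  have h4 := gap_lt hα
  have h5 : (1 / 2 - gap α) * (t + 1) ≤ c * (t + 1) := by
    apply mul_le_mul_of_nonneg_right <;> linarith
  nlinarith [mul_nonneg (sub_nonneg.2 ht) (sub_nonneg.2 h4.le)]

lemma gap_mul_le_symbol {α c : ℝ} (hα : 0 < α) (hc : |c - 1 / 2| ≤ gap α) {k : ℤ}
    (hk : 1 < |k|) : gap α * (1 + absPow α k) ≤ c * absPow α k + (c - 1) :=
  gap_mul_le hα hc (two_rpow_le_absPow hα hk)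

/-! ### Sums over the high frequencies -/

/-- The part of a family indexed by `ℤ` at the frequencies `|k| ≥ 2`. -/
def high {E : Type*} [Zero E] (f : ℤ → E) (k : ℤ) : E := if 1 < |k| then f k else 0

lemma high_of_lt {E : Type*} [Zero E] (f : ℤ → E) {k : ℤ} (hk : 1 < |k|) : high f k = f k :=
  if_pos hk

lemma high_of_not_lt {E : Type*} [Zero E] (f : ℤ → E) {k : ℤ} (hk : ¬ 1 < |k|) : high f k = 0 :=
  if_neg hk

lemma eq_of_not_one_lt_abs {k : ℤ} (hk : ¬ 1 < |k|) : k = -1 ∨ k = 0 ∨ k = 1 := by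
  rw [not_lt, abs_le] at hk
  omega

lemma hasSum_high {E : Type*} [NormedAddCommGroup E] {f : ℤ → E} {S : E} (h : HasSum f S) :
    HasSum (high f) (S - (f (-1) + f 0 + f 1)) := by
  have h1 : HasSum (fun k => f k - high f k) (∑ k ∈ ({-1, 0, 1} : Finset ℤ), (f k - high f k)) := by
    apply hasSum_sum_of_ne_finset_zero
    intro k hk
    by_cases h2 : 1 < |k|
    · simp [high, h2]
    · rcases eq_of_not_one_lt_abs h2 with h3 | h3 | h3 <;> simp [h3] at hk
  have h2 := h.sub h1
  simp only [sub_sub_cancel] at h2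
  convert h2 using 2
  simp [high]
  abel

/-! ### Fourier coefficients of even waves -/

/-- The Fourier coefficients of a real continuous function. -/
def coef (φ : C(Circ, ℝ)) (k : ℤ) : ℂ := fourierCoeff (ofC φ) k

lemma coef_eq (φ : C(Circ, ℝ)) (k : ℤ) : coef φ k = fourierCoeff (fun x : Circ => (φ x : ℂ)) k := by
  rw [coef, fourierCoeff_ofC]

lemma conj_coef (φ : C(Circ, ℝ)) (k : ℤ) : (starRingEnd ℂ) (coef φ k) = coef φ (-k) := by
  rw [coef_eq, coef_eq, fourierCoeff, fourierCoeff, ← integral_conj]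
  congr 1
  funext x
  rw [smul_eq_mul, smul_eq_mul, map_mul, Complex.conj_ofReal, ← fourier_neg]

lemma coef_neg_of_even {φ : C(Circ, ℝ)} (h : ∀ x : Circ, φ (-x) = φ x) (k : ℤ) :
    coef φ (-k) = coef φ k := by
  rw [coef_eq, coef_eq, fourierCoeff, fourierCoeff, ← integral_neg_eq_self]
  congr 1
  funext x
  rw [h x]
  congr 1
  simp only [fourier_apply, neg_neg, smul_neg, neg_smul]

lemma conj_coef_of_even {φ : C(Circ, ℝ)} (h : ∀ x : Circ, φ (-x) = φ x) (k : ℤ) :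
    (starRingEnd ℂ) (coef φ k) = coef φ k := by
  rw [conj_coef, coef_neg_of_even h]

lemma norm_coef_le (φ : C(Circ, ℝ)) (k : ℤ) : ‖coef φ k‖ ≤ ‖φ‖ :=
  (norm_fourierCoeff_le _ k).trans (norm_ofC_le φ)

lemma norm_coef_mul_le (φ ψ : C(Circ, ℝ)) (k : ℤ) :
    ‖coef (φ * ψ) k‖ ≤ ‖ofC φ‖ * ‖ofC ψ‖ := by
  let v : L2per := ContinuousMap.toLp (E := ℂ) 2 AddCircle.haarAddCircle ℂ
    (fourier k * ⟨fun x => (φ x : ℂ), Complex.continuous_ofReal.comp φ.continuous⟩)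
  have hv : v =ᵐ[AddCircle.haarAddCircle] fun x => fourier k x * (φ x : ℂ) :=
    ContinuousMap.coeFn_toLp _ _
  have h1 : coef (φ * ψ) k = inner ℂ v (ofC ψ) := by
    rw [L2.inner_def, coef_eq, fourierCoeff]
    refine integral_congr_ae ?_
    filter_upwards [hv, coeFn_ofC ψ] with x h1 h2
    rw [h1, h2, fourier_neg]
    simp only [smul_eq_mul, ContinuousMap.mul_apply, Complex.ofReal_mul, RCLike.inner_apply',
      map_mul, Complex.conj_ofReal]
    ring
  have h2 : ‖v‖ ≤ ‖ofC φ‖ := by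
    refine Lp.norm_le_norm_of_ae_le ?_
    filter_upwards [hv, coeFn_ofC φ] with x h1 h2
    rw [h1, h2, norm_mul, fourier_apply, Circle.norm_coe, one_mul]
  rw [h1]
  exact (norm_inner_le_norm _ _).trans (by gcongr)

lemma fourierCoeff_zero_eq_intervalIntegral (f : Circ → ℂ) :
    fourierCoeff f 0 = (1 / (2 * π)) • ∫ x in (-π)..π, f (x : Circ) := by
  rw [fourierCoeff_eq_intervalIntegral f 0 (-π), show -π + 2 * π = π by ring]
  simp

lemma coef_zero_eq_intervalIntegral (φ : C(Circ, ℝ)) :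
    coef φ 0 = ((1 / (2 * π) * ∫ x in (-π)..π, φ (x : Circ) : ℝ) : ℂ) := by
  rw [coef_eq, fourierCoeff_zero_eq_intervalIntegral, intervalIntegral.integral_ofReal]
  simp

lemma fourierCoeff_proj0 (φ : C(Circ, ℝ)) (k : ℤ) :
    fourierCoeff (fun x : Circ => ((proj0 (fun y => φ y) x : ℝ) : ℂ)) k
      = if k = 0 then 0 else coef φ k := by
  set m : ℝ := 1 / (2 * π) * ∫ x in (-π)..π, φ (x : Circ) with hm
  have h1 : (fun x : Circ => ((proj0 (fun y => φ y) x : ℝ) : ℂ))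
      = (fun x : Circ => (φ x : ℂ)) + (fun x : Circ => -(m : ℂ) * fourier 0 x) := by
    funext x
    simp [proj0, hm, sub_eq_add_neg]
  have hi1 : Integrable (fun x : Circ => (φ x : ℂ)) AddCircle.haarAddCircle :=
    (integrable_L2per (ofC φ)).congr (coeFn_ofC φ)
  have hi2 : Integrable (fun x : Circ => -(m : ℂ) * fourier 0 x) AddCircle.haarAddCircle := by
    simp
  rw [h1, fourierCoeff.add hi1 hi2, Pi.add_apply, ← coef_eq, fourierCoeff.const_mul,
    fourierCoeff_fourier]
  split_ifs with hk
  · subst hk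
    rw [coef_zero_eq_intervalIntegral, ← hm]
    simp
  · simp [hk]

section Wave

variable {α c : ℝ} {φ : C(Circ, ℝ)}

lemma IsEvenWave.coef_zero (hw : IsEvenWave α c φ) : coef φ 0 = 0 := by
  rw [coef_zero_eq_intervalIntegral, hw.mean_zero]
  simp

lemma IsEvenWave.coef_neg (hw : IsEvenWave α c φ) (k : ℤ) : coef φ (-k) = coef φ k :=
  coef_neg_of_even hw.even k

lemma IsEvenWave.coef_equation (hw : IsEvenWave α c φ) {k : ℤ} (hk : k ≠ 0) :
    ((c * absPow α k + (c - 1) : ℝ) : ℂ) * coef φ k = (1 / 2) * coef (φ * φ) k := by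
  have h := hw.equation k
  have h2 := fourierCoeff_proj0 (φ * φ) k
  rw [if_neg hk] at h2
  rw [coef_eq, h, ← h2]
  simp only [pow_two, ContinuousMap.mul_apply]

/-- The high frequencies of a small wave are controlled by its frequency `1`, because
`c |k|^α + c - 1` stays away from zero there. -/
lemma IsEvenWave.high_le (hα : 0 < α) (hw : IsEvenWave α c φ) (hc : |c - 1 / 2| ≤ gap α)
    {η : ℝ} (hη₁ : η ≤ 1) (hφ : ‖φ‖ ≤ η * gap α) :
    Summable (high fun k => ((1 + absPow α k) * ‖coef φ k‖) ^ 2) ∧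
    ∑' k, high (fun k => ((1 + absPow α k) * ‖coef φ k‖) ^ 2) k ≤ η ^ 2 * ‖coef φ 1‖ ^ 2 ∧
    ‖ofC φ‖ ^ 2 ≤ 3 * ‖coef φ 1‖ ^ 2 := by
  have hκ := gap_pos hα
  have hη : 0 ≤ η := nonneg_of_mul_nonneg_left ((norm_nonneg _).trans hφ) hκ
  set F : ℤ → ℝ := high fun k => ((1 + absPow α k) * ‖coef φ k‖) ^ 2 with hF
  have hF0 : ∀ k, 0 ≤ F k := by
    intro k
    rw [hF, high]
    split_ifs <;> positivity
  have h1 : ∀ k, F k ≤ (1 / (2 * gap α)) ^ 2 * ‖coef (φ * φ) k‖ ^ 2 := by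
    intro k
    rw [hF, high]
    split_ifs with hk
    · have hk0 : k ≠ 0 := by
        rintro rfl
        simp at hk
      have h2 := congrArg norm (hw.coef_equation hk0)
      have h3 := gap_mul_le_symbol hα hc hk
      have h4 : 0 ≤ gap α * (1 + absPow α k) :=
        mul_nonneg hκ.le (add_nonneg zero_le_one (absPow_nonneg α k))
      rw [norm_mul, norm_mul, Complex.norm_real, Real.norm_eq_abs,
        abs_of_nonneg (h4.trans h3)] at h2
      have h5 : gap α * (1 + absPow α k) * ‖coef φ k‖ ≤ 1 / 2 * ‖coef (φ * φ) k‖ := by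
        calc _ ≤ (c * absPow α k + (c - 1)) * ‖coef φ k‖ := by gcongr
          _ = _ := by rw [h2]; norm_num
      rw [← mul_pow]
      have h6 := absPow_nonneg α k
      refine pow_le_pow_left₀ (by positivity) ?_ 2
      rw [div_mul_eq_mul_div, le_div_iff₀ (by positivity)]
      linarith
    · positivity
  have h2 := (hasSum_norm_sq (ofC (φ * φ))).mul_left ((1 / (2 * gap α)) ^ 2)
  have hs : Summable F := Summable.of_nonneg_of_le hF0 h1 h2.summable
  have h3 : ∑' k, F k ≤ (1 / (2 * gap α)) ^ 2 * ‖ofC (φ * φ)‖ ^ 2 := hasSum_le h1 hs.hasSum h2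
  have h4 : ‖ofC (φ * φ)‖ ≤ η * gap α * ‖ofC φ‖ := by
    rw [← mulL2_ofC]
    exact (norm_mulL2_le _ _).trans (by gcongr)
  have h5 : ∑' k, F k ≤ η ^ 2 / 4 * ‖ofC φ‖ ^ 2 := by
    calc _ ≤ (1 / (2 * gap α)) ^ 2 * (η * gap α * ‖ofC φ‖) ^ 2 := h3.trans (by gcongr)
      _ = _ := by field_simp; ring
  have h6 : ‖ofC φ‖ ^ 2 ≤ 2 * ‖coef φ 1‖ ^ 2 + ∑' k, F k := by
    have h7 : HasSum (fun k => ‖coef φ k‖ ^ 2) _ := hasSum_norm_sq (ofC φ)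
    have h8 := hasSum_high h7
    have h9 : ∀ k, high (fun k => ‖coef φ k‖ ^ 2) k ≤ F k := by
      intro k
      rw [hF, high, high]
      have h6 := absPow_nonneg α k
      split_ifs
      · gcongr
        exact le_mul_of_one_le_left (norm_nonneg _) (by linarith)
      · exact le_rfl
    have h10 := hasSum_le h9 h8 hs.hasSum
    simp only [hw.coef_neg, hw.coef_zero, norm_zero] at h10
    linarith
  have h7 : η ^ 2 ≤ 1 := pow_le_one₀ hη hη₁
  have h8 : η ^ 2 * ‖ofC φ‖ ^ 2 ≤ ‖ofC φ‖ ^ 2 := mul_le_of_le_one_left (by positivity) h7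
  have h9 : ‖ofC φ‖ ^ 2 ≤ 3 * ‖coef φ 1‖ ^ 2 := by linarith [sq_nonneg ‖coef φ 1‖]
  refine ⟨hs, ?_, h9⟩
  have h10 : η ^ 2 * ‖ofC φ‖ ^ 2 ≤ η ^ 2 * (3 * ‖coef φ 1‖ ^ 2) := by gcongr
  nlinarith [mul_nonneg (sq_nonneg η) (sq_nonneg ‖coef φ 1‖)]

lemma eq_zero_of_coef {φ : C(Circ, ℝ)} (h : ∀ k, coef φ k = 0) : φ = 0 := by
  have h1 : Summable (fourierCoeff (⟨fun x => (φ x : ℂ),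
      Complex.continuous_ofReal.comp φ.continuous⟩ : C(Circ, ℂ))) := by
    have : fourierCoeff (⟨fun x => (φ x : ℂ),
      Complex.continuous_ofReal.comp φ.continuous⟩ : C(Circ, ℂ)) = 0 := by
      funext k
      exact (coef_eq φ k).symm.trans (h k)
    rw [this]
    exact summable_zero
  ext x
  have h2 := has_pointwise_sum_fourier_series_of_summable h1 x
  have h3 : ∀ k, fourierCoeff (⟨fun x => (φ x : ℂ),
      Complex.continuous_ofReal.comp φ.continuous⟩ : C(Circ, ℂ)) k = 0 :=
    fun k => (coef_eq φ k).symm.trans (h k)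
  simp only [h3, zero_smul] at h2
  have h4 := h2.unique hasSum_zero
  simpa using h4

/-- A small even wave without frequency `1` vanishes. -/
lemma IsEvenWave.coef_one_ne_zero (hα : 0 < α) (hw : IsEvenWave α c φ) (hc : |c - 1 / 2| ≤ gap α)
    (hφ : ‖φ‖ ≤ gap α) (h0 : φ ≠ 0) : coef φ 1 ≠ 0 := by
  intro h1
  obtain ⟨-, -, h2⟩ := hw.high_le hα hc le_rfl (by simpa using hφ)
  have h3 : ofC φ = 0 := by
    rw [h1] at h2
    rw [← norm_eq_zero]
    apply pow_eq_zero_iff two_ne_zero |>.1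
    apply le_antisymm <;> [simpa using h2; positivity]
  apply h0
  apply eq_zero_of_coef
  intro k
  rw [coef, h3, fourierCoeff_zero']

/-- Two small even waves with the same nonzero frequency `1` coincide, and so do their speeds. The
equation at `k = 1` bounds the difference of the speeds by the `L²` distance `‖d‖` of the waves;
the equations at `|k| ≥ 2` then give `‖d‖ ≤ θ ‖d‖` with `θ < 1`. -/
theorem IsEvenWave.eq_of_coef_one_eq (hα : 0 < α) {c' : ℝ} {ψ : C(Circ, ℝ)}
    (hψ : IsEvenWave α c' ψ) (hφ : IsEvenWave α c φ) (hc' : |c' - 1 / 2| ≤ gap α)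
    (hc : |c - 1 / 2| ≤ gap α) (nψ : ‖ψ‖ ≤ 1 / 2 * gap α) (nφ : ‖φ‖ ≤ 1 / 2 * gap α)
    (h1 : coef ψ 1 = coef φ 1) (h0 : coef φ 1 ≠ 0) : c' = c ∧ ψ = φ := by
  have hκ := gap_pos hα
  obtain ⟨hs, hT, hN⟩ := hψ.high_le hα hc' (η := 1 / 2) (by norm_num) nψ
  obtain ⟨-, -, hN'⟩ := hφ.high_le hα hc (η := 1 / 2) (by norm_num) nφ
  set d : L2per := ofC (ψ - φ) with hd
  set p := ‖coef φ 1‖ with hp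
  have hp0 : 0 < p := norm_pos_iff.2 h0
  rw [h1, ← hp] at hN hT
  have hpκ : p ≤ 1 / 2 * gap α := (norm_coef_le φ 1).trans nφ
  have hdk : ∀ k, fourierCoeff d k = coef ψ k - coef φ k := by
    intro k
    rw [hd, ofC_sub, fourierCoeff_sub', coef, coef]
  have hB : mulL2 (ψ + φ) d = ofC (ψ * ψ) - ofC (φ * φ) := by
    rw [hd, mulL2_ofC, ← ofC_sub]
    congr 1
    ring
  have hBn : ‖mulL2 (ψ + φ) d‖ ≤ gap α * ‖d‖ := by
    refine (norm_mulL2_le _ _).trans ?_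
    gcongr
    exact (norm_add_le _ _).trans (by linarith)
  have hBk : ∀ k, fourierCoeff (mulL2 (ψ + φ) d) k = coef (ψ * ψ) k - coef (φ * φ) k := by
    intro k
    rw [hB, fourierCoeff_sub', coef, coef]
  have hC : |c' - c| ≤ ‖d‖ := by
    have e1 := hψ.coef_equation one_ne_zero
    have e2 := hφ.coef_equation one_ne_zero
    rw [absPow_one, h1] at e1
    rw [absPow_one] at e2
    have e3 : ((2 * (c' - c) : ℝ) : ℂ) * coef φ 1
        = 1 / 2 * fourierCoeff (mulL2 (ψ + φ) d) 1 := by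
      push_cast at e1 e2 ⊢
      rw [hBk]
      linear_combination e1 - e2
    have e4 : ‖fourierCoeff (mulL2 (ψ + φ) d) 1‖ ≤ 4 * p * ‖d‖ := by
      have e5 : ‖ofC (ψ + φ)‖ ≤ 4 * p := by
        rw [ofC_add]
        have e6 : ‖ofC ψ‖ ≤ 2 * p := abs_le_of_sq_le_sq' (by nlinarith) (by positivity) |>.2
        have e7 : ‖ofC φ‖ ≤ 2 * p := abs_le_of_sq_le_sq' (by nlinarith) (by positivity) |>.2
        exact (norm_add_le _ _).trans (by linarith)
      rw [hd, mulL2_ofC]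
      exact (norm_coef_mul_le _ _ 1).trans (by gcongr)
    have e5 := congrArg norm e3
    rw [norm_mul, norm_mul, Complex.norm_real, Real.norm_eq_abs, abs_mul, ← hp] at e5
    norm_num at e5
    have e6 : |c' - c| * p ≤ ‖d‖ * p := by linarith
    exact le_of_mul_le_mul_right e6 hp0
  have hd0 : ‖d‖ ^ 2 ≤ 2 * (1 / gap α) ^ 2 * ‖d‖ ^ 2 *
        ∑' k, high (fun k => ((1 + absPow α k) * ‖coef ψ k‖) ^ 2) k
      + 2 * (1 / (2 * gap α)) ^ 2 * ‖mulL2 (ψ + φ) d‖ ^ 2 := by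
    refine hasSum_le (fun k => ?_) (hasSum_norm_sq d) ((hs.hasSum.mul_left _).add
      ((hasSum_norm_sq (mulL2 (ψ + φ) d)).mul_left _))
    by_cases hk : 1 < |k|
    · rw [high_of_lt _ hk]
      have hk0 : k ≠ 0 := by
        rintro rfl
        simp at hk
      have e1 := hψ.coef_equation hk0
      have e2 := hφ.coef_equation hk0
      have t0 := absPow_nonneg α k
      have e3 : ((c * absPow α k + (c - 1) : ℝ) : ℂ) * fourierCoeff d k
          = 1 / 2 * fourierCoeff (mulL2 (ψ + φ) d) k
            - ((c' - c : ℝ) : ℂ) * ((1 + absPow α k : ℝ) : ℂ) * coef ψ k := by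
        push_cast at e1 e2 ⊢
        rw [hBk, hdk]
        linear_combination e1 - e2
      have e4 := gap_mul_le_symbol hα hc hk
      have e5 : gap α * ‖fourierCoeff d k‖ ≤ 1 / 2 * ‖fourierCoeff (mulL2 (ψ + φ) d) k‖
          + ‖d‖ * ((1 + absPow α k) * ‖coef ψ k‖) := by
        calc gap α * ‖fourierCoeff d k‖ ≤ (c * absPow α k + (c - 1)) * ‖fourierCoeff d k‖ := by
              gcongr
              nlinarith
          _ = ‖((c * absPow α k + (c - 1) : ℝ) : ℂ) * fourierCoeff d k‖ := by
              rw [norm_mul, Complex.norm_real, Real.norm_eq_abs, abs_of_nonneg]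
              nlinarith
          _ ≤ _ := by
              rw [e3]
              refine (norm_sub_le _ _).trans ?_
              rw [norm_mul, norm_mul, norm_mul, Complex.norm_real, Complex.norm_real,
                Real.norm_eq_abs, Real.norm_eq_abs, abs_of_nonneg (add_nonneg zero_le_one t0),
                mul_assoc]
              gcongr
              norm_num
      have e6 : ‖fourierCoeff d k‖ ≤ 1 / (2 * gap α) * ‖fourierCoeff (mulL2 (ψ + φ) d) k‖
          + 1 / gap α * ‖d‖ * ((1 + absPow α k) * ‖coef ψ k‖) := by
        rw [mul_comm, ← le_div_iff₀ hκ] at e5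
        refine e5.trans (le_of_eq ?_)
        field_simp
      have e7 := pow_le_pow_left₀ (norm_nonneg _) e6 2
      refine e7.trans (add_sq_le.trans (le_of_eq ?_))
      ring
    · rw [high_of_not_lt _ hk]
      have e1 : fourierCoeff d k = 0 := by
        rw [hdk]
        rcases eq_of_not_one_lt_abs hk with rfl | rfl | rfl
        · rw [hψ.coef_neg, hφ.coef_neg, h1, sub_self]
        · rw [hψ.coef_zero, hφ.coef_zero, sub_self]
        · rw [h1, sub_self]
      rw [e1, norm_zero, zero_pow two_ne_zero]
      positivity
  have hd1 : ‖d‖ ^ 2 ≤ 5 / 8 * ‖d‖ ^ 2 := by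
    refine hd0.trans ?_
    calc _ ≤ 2 * (1 / gap α) ^ 2 * ‖d‖ ^ 2 * ((1 / 2) ^ 2 * (1 / 2 * gap α) ^ 2)
          + 2 * (1 / (2 * gap α)) ^ 2 * (gap α * ‖d‖) ^ 2 := by
          gcongr
          exact hT.trans (by gcongr)
      _ = _ := by field_simp; ring
  have hd2 : ‖d‖ = 0 := pow_eq_zero_iff two_ne_zero |>.1 (by nlinarith [sq_nonneg ‖d‖])
  constructor
  · rw [hd2] at hC
    exact sub_eq_zero.1 (abs_nonpos_iff.1 hC)
  · refine sub_eq_zero.1 (eq_zero_of_coef fun k => ?_)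
    rw [coef, ← hd, norm_eq_zero.1 hd2, fourierCoeff_zero']

/-- The wave equation in terms of Fourier coefficients. -/
lemma isEvenWave_of_coef (h₁ : ContDiff ℝ ∞ (fun x : ℝ => φ (x : Circ)))
    (h₂ : ∀ x : Circ, φ (-x) = φ x) (h₃ : coef φ 0 = 0)
    (h₄ : ∀ k : ℤ, k ≠ 0 →
      ((c * absPow α k + (c - 1) : ℝ) : ℂ) * coef φ k = (1 / 2) * coef (φ * φ) k) :
    IsEvenWave α c φ where
  smooth := h₁
  even := h₂
  mean_zero := by
    rw [coef_zero_eq_intervalIntegral, Complex.ofReal_eq_zero] at h₃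
    exact (mul_eq_zero.1 h₃).resolve_left (by positivity)
  equation k := by
    have h := fourierCoeff_proj0 (φ * φ) k
    have h' : (fun y : Circ => φ y ^ 2) = fun y => (φ * φ) y := funext fun y => pow_two _
    rw [← coef_eq, h', h]
    split_ifs with hk
    · rw [hk, h₃, mul_zero, mul_zero]
    · exact h₄ k hk

/-- The translate of a function by half a period. -/
def halfShift (φ : C(Circ, ℝ)) : C(Circ, ℝ) :=
  φ.comp ⟨fun x => x + ((π : ℝ) : Circ), by fun_prop⟩

lemma halfShift_apply (φ : C(Circ, ℝ)) (x : Circ) : halfShift φ x = φ (x + ((π : ℝ) : Circ)) := rfl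

lemma coe_pi_add_coe_pi : ((π : ℝ) : Circ) + ((π : ℝ) : Circ) = 0 := by
  rw [← AddCircle.coe_add, ← two_mul]
  exact AddCircle.coe_period _

lemma halfShift_halfShift (φ : C(Circ, ℝ)) : halfShift (halfShift φ) = φ := by
  ext x
  rw [halfShift_apply, halfShift_apply, add_assoc, coe_pi_add_coe_pi, add_zero]

lemma coef_halfShift (φ : C(Circ, ℝ)) (k : ℤ) :
    coef (halfShift φ) k = fourier k ((π : ℝ) : Circ) * coef φ k := by
  rw [coef_eq, coef_eq, fourierCoeff, fourierCoeff, ← integral_const_mul,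
    ← integral_add_right_eq_self _ ((π : ℝ) : Circ)]
  congr 1
  funext x
  rw [halfShift_apply, add_assoc, coe_pi_add_coe_pi, add_zero]
  have h : fourier (-k) (x + ((π : ℝ) : Circ)) = fourier k ((π : ℝ) : Circ) * fourier (-k) x := by
    have h2 : k • ((π : ℝ) : Circ) = -k • ((π : ℝ) : Circ) := by
      rw [neg_smul, eq_neg_iff_add_eq_zero, ← smul_add, coe_pi_add_coe_pi, smul_zero]
    rw [fourier_apply, fourier_apply, fourier_apply, h2, smul_add, AddCircle.toCircle_add,
      Circle.coe_mul, mul_comm]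
  rw [h, smul_eq_mul, smul_eq_mul, mul_assoc]

lemma coef_one_halfShift (φ : C(Circ, ℝ)) : coef (halfShift φ) 1 = -coef φ 1 := by
  rw [coef_halfShift, fourier_coe_apply]
  have h : 2 * (π : ℂ) * Complex.I * ((1 : ℤ) : ℂ) * (π : ℂ) / ((2 * π : ℝ) : ℂ)
      = π * Complex.I := by
    have : (π : ℂ) ≠ 0 := Complex.ofReal_ne_zero.2 Real.pi_ne_zero
    push_cast
    field_simp
  rw [h, Complex.exp_pi_mul_I, neg_one_mul]

lemma norm_halfShift_le (φ : C(Circ, ℝ)) : ‖halfShift φ‖ ≤ ‖φ‖ :=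
  (ContinuousMap.norm_le _ (norm_nonneg _)).2 fun _ => φ.norm_coe_le_norm _

lemma IsEvenWave.halfShift (hw : IsEvenWave α c φ) : IsEvenWave α c (halfShift φ) := by
  refine isEvenWave_of_coef ?_ (fun x => ?_) ?_ (fun k hk => ?_)
  · have h := hw.smooth.comp (contDiff_id.add contDiff_const : ContDiff ℝ ∞ fun x : ℝ => x + π)
    exact h
  · rw [halfShift_apply, halfShift_apply, ← hw.even, neg_add, neg_neg,
      neg_eq_of_add_eq_zero_left coe_pi_add_coe_pi]
  · rw [coef_halfShift, hw.coef_zero, mul_zero]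
  · have h : FBBM.halfShift φ * FBBM.halfShift φ = FBBM.halfShift (φ * φ) := rfl
    rw [h, coef_halfShift, coef_halfShift, mul_left_comm, hw.coef_equation hk]
    ring

end Wave

/-! ### The derivative of a wave -/

lemma hasDerivAt_fourier_circ (k : ℤ) (x : ℝ) :
    HasDerivAt (fun y : ℝ => (fourier k (y : Circ) : ℂ))
      (Complex.I * k * fourier k (x : Circ)) x := by
  have h := hasDerivAt_fourier (2 * π) k x
  refine h.congr_deriv ?_
  have h2 : 2 * (π : ℂ) * Complex.I * k / ((2 * π : ℝ) : ℂ) = Complex.I * k := by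
    rw [div_eq_iff (Complex.ofReal_ne_zero.2 Real.two_pi_pos.ne')]
    push_cast
    ring
  rw [h2]

lemma coef_of_hasDerivAt {f g : C(Circ, ℝ)}
    (h : ∀ x : ℝ, HasDerivAt (fun y : ℝ => f (y : Circ)) (g (x : Circ)) x) (k : ℤ) :
    coef g k = Complex.I * k * coef f k := by
  have h1 : ∀ x : ℝ, HasDerivAt (fun y : ℝ => (fourier (-k) (y : Circ) : ℂ) * (f (y : Circ) : ℂ))
      (fourier (-k) (x : Circ) * (g (x : Circ) : ℂ)
        - Complex.I * k * (fourier (-k) (x : Circ) * (f (x : Circ) : ℂ))) x := by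
    intro x
    have h2 := (hasDerivAt_fourier_circ (-k) x).mul (h x).ofReal_comp
    refine h2.congr_deriv ?_
    rw [Int.cast_neg]
    ring
  have c0 : Continuous fun x : ℝ => (x : Circ) := AddCircle.continuous_mk' _
  have c1 : Continuous fun x : ℝ => fourier (-k) (x : Circ) * (g (x : Circ) : ℂ) :=
    ((fourier (-k)).continuous.comp c0).mul
      (Complex.continuous_ofReal.comp (g.continuous.comp c0))
  have c2 : Continuous fun x : ℝ => fourier (-k) (x : Circ) * (f (x : Circ) : ℂ) :=
    ((fourier (-k)).continuous.comp c0).mul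
      (Complex.continuous_ofReal.comp (f.continuous.comp c0))
  have c3 : Continuous fun x : ℝ =>
      Complex.I * k * (fourier (-k) (x : Circ) * (f (x : Circ) : ℂ)) := continuous_const.mul c2
  have h3 := intervalIntegral.integral_eq_sub_of_hasDerivAt (a := 0) (b := 0 + 2 * π)
    (fun x _ => h1 x) ((c1.sub c3).intervalIntegrable _ _)
  rw [intervalIntegral.integral_sub (c1.intervalIntegrable _ _)
    (c3.intervalIntegrable _ _), intervalIntegral.integral_const_mul] at h3
  have h4 : ((0 + 2 * π : ℝ) : Circ) = ((0 : ℝ) : Circ) := by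
    rw [zero_add]
    exact AddCircle.coe_period _
  rw [h4, sub_self, sub_eq_zero] at h3
  rw [coef_eq, coef_eq, fourierCoeff_eq_intervalIntegral _ _ 0,
    fourierCoeff_eq_intervalIntegral _ _ 0]
  simp only [smul_eq_mul]
  rw [h3, mul_smul_comm]

/-- The derivative of a smooth function on the circle. -/
lemma exists_hasDerivAt {f : C(Circ, ℝ)} (hf : ContDiff ℝ ∞ (fun x : ℝ => f (x : Circ))) :
    ∃ g : C(Circ, ℝ), ∀ x : ℝ, HasDerivAt (fun y : ℝ => f (y : Circ)) (g (x : Circ)) x := by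
  have hd := hf.differentiable (by simp)
  have hp : Function.Periodic (deriv fun x : ℝ => f (x : Circ)) (2 * π) := by
    intro x
    rw [← deriv_comp_add_const]
    congr 1
    funext y
    rw [AddCircle.coe_add, AddCircle.coe_period, add_zero]
  refine ⟨⟨hp.lift, ?_⟩, fun x => ?_⟩
  · exact continuous_coinduced_dom.2 (hf.continuous_deriv (by simp))
  · exact (hd x).hasDerivAt

/-! ### Imaginary eigenvalues -/

section Stability

variable {α c : ℝ} {φ : C(Circ, ℝ)}

lemma linCoeff_of_ne_zero (u : L2per) {k : ℤ} (hk : k ≠ 0) :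
    linCoeff α c φ u k = ((c * absPow α k + (c - 1) : ℝ) : ℂ) * fourierCoeff u k
      - fourierCoeff (mulL2 φ u) k := by
  rw [linCoeff, if_neg hk, fourierCoeff_mulFun, add_zero]

lemma abs_re_le_norm_symbol (c : ℝ) (μ : ℂ) (k : ℤ) : |μ.re| ≤ ‖Complex.I * c * k - μ‖ := by
  have h := Complex.abs_re_le_norm (Complex.I * c * k - μ)
  simpa using h

/-- The symbol of `∂ₓ (c ∂ₓ - μ)⁻¹` is bounded when `μ` is not imaginary. -/
lemma abs_le_mul_norm_symbol {c : ℝ} (hc : 0 < c) {μ : ℂ} (hμ : μ.re ≠ 0) (k : ℤ) :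
    |(k : ℝ)| ≤ (1 + ‖μ‖ / |μ.re|) / c * ‖Complex.I * c * k - μ‖ := by
  have h1 := abs_re_le_norm_symbol c μ k
  have h2 : c * |(k : ℝ)| ≤ ‖Complex.I * c * k - μ‖ + ‖μ‖ := by
    have h3 : ‖Complex.I * c * k‖ = c * |(k : ℝ)| := by
      simp [abs_of_pos hc]
    rw [← h3]
    simpa using norm_add_le (Complex.I * c * k - μ) μ
  have h3 : 0 < |μ.re| := abs_pos.2 hμ
  have h4 : ‖μ‖ ≤ ‖μ‖ / |μ.re| * ‖Complex.I * c * k - μ‖ := by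
    rw [div_mul_eq_mul_div, le_div_iff₀ h3]
    gcongr
  rw [div_mul_eq_mul_div, le_div_iff₀ hc]
  linarith

/-- The eigenvalue equation `J ℒ u = μ u` with the transport part on the left. -/
lemma eigen_equation_iff (μ : ℂ) (u : L2per) {k : ℤ} (hk : k ≠ 0) :
    ((1 + absPow α k : ℝ) : ℂ) * (μ * fourierCoeff u k) = Complex.I * k * linCoeff α c φ u k ↔
    ((1 + absPow α k : ℝ) : ℂ) * (Complex.I * c * k - μ) * fourierCoeff u k
      = Complex.I * k * (fourierCoeff u k + fourierCoeff (mulL2 φ u) k) := by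
  rw [linCoeff_of_ne_zero u hk]
  push_cast
  constructor <;> intro h <;> linear_combination -h

lemma summable_mul_of_sq {f g : ℤ → ℂ} (hf : Summable fun k => ‖f k‖ ^ 2)
    (hg : Summable fun k => ‖g k‖ ^ 2) : Summable fun k => f k * g k := by
  refine Summable.of_norm_bounded (hf.add hg) fun k => ?_
  rw [norm_mul]
  nlinarith [sq_nonneg (‖f k‖ - ‖g k‖), sq_nonneg (‖f k‖), sq_nonneg ‖g k‖]

lemma tsum_eq_zero_of_odd {f : ℤ → ℂ} (h : ∀ k, f (-k) = -f k) : ∑' k, f k = 0 := by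
  have h1 : ∑' k, f (-k) = ∑' k, f k := (Equiv.neg ℤ).tsum_eq f
  simp only [h, tsum_neg] at h1
  exact self_eq_neg.1 h1.symm

/-- A form which vanishes at an eigenfunction: with `r k = ((1 + |k|^α) / k) |u_k|²` one has
`⟨ℒ u, u⟩ = -i μ ∑ r k`, while `⟨ℒ u, u⟩` and `∑ r k` are real. -/
lemma hasSum_linCoeff_mul_conj {μ : ℂ} (hμ : μ.re ≠ 0) {u : L2per}
    (h0 : fourierCoeff u 0 = 0)
    (hu : ∀ k : ℤ, k ≠ 0 → ((1 + absPow α k : ℝ) : ℂ) * (μ * fourierCoeff u k)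
      = Complex.I * k * linCoeff α c φ u k)
    (hs : Summable fun k => ‖((1 + absPow α k : ℝ) : ℂ) * fourierCoeff u k‖ ^ 2) :
    HasSum (fun k => (starRingEnd ℂ) (fourierCoeff u k) * linCoeff α c φ u k) 0 := by
  have hsu := (hasSum_norm_sq u).summable
  have e0 : ∀ k, ((‖fourierCoeff u k‖ ^ 2 : ℝ) : ℂ)
      = (starRingEnd ℂ) (fourierCoeff u k) * fourierCoeff u k := by
    intro k
    rw [← Complex.normSq_eq_norm_sq, Complex.normSq_eq_conj_mul_self]
  have e1 : Summable fun k : ℤ => (1 + absPow α k) * ‖fourierCoeff u k‖ ^ 2 := by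
    refine Summable.of_nonneg_of_le (fun k => ?_) (fun k => ?_) (hs.add hsu)
    · have := absPow_nonneg α k
      positivity
    · have := absPow_nonneg α k
      rw [norm_mul, Complex.norm_real, Real.norm_eq_abs, abs_of_nonneg (by positivity)]
      nlinarith [sq_nonneg ((1 + absPow α k) * ‖fourierCoeff u k‖ - ‖fourierCoeff u k‖),
        sq_nonneg ((1 + absPow α k) * ‖fourierCoeff u k‖), sq_nonneg ‖fourierCoeff u k‖]
  set r : ℤ → ℝ := fun k => (1 + absPow α k) / k * ‖fourierCoeff u k‖ ^ 2 with hr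
  have e2 : Summable r := by
    refine Summable.of_norm_bounded e1 fun k => ?_
    have := absPow_nonneg α k
    rw [hr, norm_mul, norm_div, Real.norm_eq_abs, Real.norm_eq_abs, Real.norm_eq_abs,
      abs_of_nonneg (by positivity : (0 : ℝ) ≤ 1 + absPow α k),
      abs_of_nonneg (by positivity : (0 : ℝ) ≤ ‖fourierCoeff u k‖ ^ 2)]
    gcongr
    by_cases hk : k = 0
    · simp only [hk, Int.cast_zero, abs_zero, div_zero]
      have := absPow_nonneg α 0
      positivity
    · apply div_le_self (by positivity)
      have : (1 : ℤ) ≤ |k| := Int.one_le_abs hk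
      exact_mod_cast this
  set q : ℤ → ℝ := fun k => (c * absPow α k + (c - 1)) * ‖fourierCoeff u k‖ ^ 2 with hq
  have e3 : Summable q := by
    have := (e1.mul_left c).sub hsu
    refine this.congr fun k => ?_
    rw [hq]
    ring
  have e4 : ∀ k, (starRingEnd ℂ) (fourierCoeff u k) * linCoeff α c φ u k
      = -Complex.I * μ * (r k : ℂ) := by
    intro k
    by_cases hk : k = 0
    · subst hk
      simp [hr, h0]
    · have hk' : (k : ℂ) ≠ 0 := by exact_mod_cast hk
      have h1 := hu k hk
      rw [hr]
      push_cast
      rw [← Complex.ofReal_pow, e0]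
      field_simp
      push_cast at h1
      linear_combination Complex.I * (starRingEnd ℂ) (fourierCoeff u k) * h1
        + k * (starRingEnd ℂ) (fourierCoeff u k) * linCoeff α c φ u k * Complex.I_sq
  have e5 : ∀ k, (starRingEnd ℂ) (fourierCoeff u k) * linCoeff α c φ u k
      = (q k : ℂ) - (starRingEnd ℂ) (fourierCoeff u k) * fourierCoeff (mulL2 φ u) k := by
    intro k
    by_cases hk : k = 0
    · subst hk
      simp [hq, h0]
    · rw [linCoeff_of_ne_zero u hk, hq, Complex.ofReal_mul, e0]
      ring
  have e6 := (Complex.hasSum_ofReal.2 e3.hasSum).sub (hasSum_inner u (mulL2 φ u))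
  have e7 := (Complex.hasSum_ofReal.2 e2.hasSum).mul_left (-Complex.I * μ)
  have e8 : (inner ℂ u (mulL2 φ u)).im = 0 := by
    have h := inner_conj_symm (𝕜 := ℂ) u (mulL2 φ u)
    rw [inner_mulL2] at h
    exact Complex.conj_eq_iff_im.1 h
  have e9 := (e6.congr_fun e5).unique (e7.congr_fun e4)
  have e10 := congrArg Complex.im e9
  simp [e8] at e10
  have e11 : ∑' k, r k = 0 := e10.resolve_left hμ
  have := e7.congr_fun e4
  rwa [e11, Complex.ofReal_zero, mul_zero] at this

lemma coef_mul_deriv {g : C(Circ, ℝ)}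
    (hg : ∀ x : ℝ, HasDerivAt (fun y : ℝ => φ (y : Circ)) (g (x : Circ)) x) (k : ℤ) :
    coef (φ * g) k = Complex.I * k / 2 * coef (φ * φ) k := by
  have h : ∀ x : ℝ, HasDerivAt (fun y : ℝ => (φ * φ) (y : Circ)) ((φ * g + φ * g) (x : Circ)) x := by
    intro x
    refine ((hg x).mul (hg x)).congr_deriv ?_
    change _ = φ (x : Circ) * g (x : Circ) + φ (x : Circ) * g (x : Circ)
    ring
  have h2 := coef_of_hasDerivAt h k
  rw [coef, ofC_add, fourierCoeff_add', ← coef] at h2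
  linear_combination h2 / 2

/-- Orthogonality of an eigenfunction to `(1 + D^α) φ`, which lies in the kernel of the adjoint of
`J ℒ`. The sum is `μ⁻¹ (⟨φ', φ u⟩ - ⟨φ φ', u⟩)`, by the equation for `φ`. -/
lemma hasSum_constraint (hw : IsEvenWave α c φ) {g : C(Circ, ℝ)}
    (hg : ∀ x : ℝ, HasDerivAt (fun y : ℝ => φ (y : Circ)) (g (x : Circ)) x)
    {μ : ℂ} (hμ : μ ≠ 0) {u : L2per} (h0 : fourierCoeff u 0 = 0)
    (hu : ∀ k : ℤ, k ≠ 0 → ((1 + absPow α k : ℝ) : ℂ) * (μ * fourierCoeff u k)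
      = Complex.I * k * linCoeff α c φ u k) :
    HasSum (fun k => ((1 + absPow α k : ℝ) : ℂ) * coef φ k * fourierCoeff u k) 0 := by
  have hgk := coef_of_hasDerivAt hg
  have hgφ := coef_mul_deriv hg
  have e1 := (hasSum_inner (ofC g) (mulL2 φ u)).sub (hasSum_inner (ofC (φ * g)) u)
  rw [← mulL2_ofC, inner_mulL2, sub_self] at e1
  have e2 := e1.mul_left μ⁻¹
  rw [mul_zero] at e2
  refine e2.congr_fun fun k => ?_
  have h1 : (starRingEnd ℂ) (fourierCoeff (ofC g) k) = -(Complex.I * k * coef φ k) := by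
    rw [← coef, hgk, map_mul, map_mul, conj_coef_of_even hw.even]
    simp
  have h2 : (starRingEnd ℂ) (fourierCoeff (mulL2 φ (ofC g)) k)
      = -(Complex.I * k / 2 * coef (φ * φ) k) := by
    rw [mulL2_ofC, ← coef, hgφ, map_mul, map_div₀, map_mul, conj_coef_of_even]
    · simp [neg_div, map_ofNat]
    · intro x
      simp [hw.even]
  rw [h1, h2]
  by_cases hk : k = 0
  · subst hk
    simp [h0]
  · have h3 := hu k hk
    have h4 := hw.coef_equation hk
    rw [linCoeff_of_ne_zero u hk] at h3
    field_simp
    linear_combination 2 * coef φ k * h3 + 2 * Complex.I * k * fourierCoeff u k * h4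

/-- A small even wave with `c ≥ 1/2` has no eigenfunction for a non-imaginary `μ`. Modulo `φ'`,
which lies in the kernel of `ℒ`, the constraint makes the frequencies `±1` of an eigenfunction small
compared with its higher frequencies, and there `ℒ` is positive definite. -/
theorem IsEvenWave.eigenfunction_eq_zero (hα : 0 < α) (hw : IsEvenWave α c φ)
    (hc : |c - 1 / 2| ≤ gap α) (hc' : 1 / 2 ≤ c) (nφ : ‖φ‖ ≤ 1 / 2 * gap α) (h1 : coef φ 1 ≠ 0)
    {μ : ℂ} (hμ : μ.re ≠ 0) {u : L2per} (h0 : fourierCoeff u 0 = 0)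
    (hu : ∀ k : ℤ, k ≠ 0 → ((1 + absPow α k : ℝ) : ℂ) * (μ * fourierCoeff u k)
      = Complex.I * k * linCoeff α c φ u k) : u = 0 := by
  have hκ := gap_pos hα
  have hc0 : 0 < c := by linarith
  have hμ0 : μ ≠ 0 := by
    rintro rfl
    simp at hμ
  obtain ⟨hs, hT, -⟩ := hw.high_le hα hc (η := 1 / 2) (by norm_num) nφ
  obtain ⟨g, hg⟩ := exists_hasDerivAt hw.smooth
  have hgk := coef_of_hasDerivAt hg
  -- an eigenfunction lies in the domain of `D^α`
  have su : Summable fun k => ‖((1 + absPow α k : ℝ) : ℂ) * fourierCoeff u k‖ ^ 2 := by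
    set M := (1 + ‖μ‖ / |μ.re|) / c with hM
    have hM0 : 0 ≤ M := by positivity
    refine Summable.of_nonneg_of_le (fun k => by positivity) (fun k => ?_)
      ((hasSum_norm_sq (u + mulL2 φ u)).summable.mul_left (M ^ 2))
    rw [← mul_pow]
    refine pow_le_pow_left₀ (norm_nonneg _) ?_ 2
    by_cases hk : k = 0
    · subst hk
      rw [h0, mul_zero, norm_zero]
      positivity
    · have e1 := (eigen_equation_iff μ u hk).1 (hu k hk)
      have e2 := congrArg norm e1
      rw [← fourierCoeff_add', norm_mul, norm_mul, norm_mul, norm_mul, Complex.norm_I, one_mul,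
        Complex.norm_intCast] at e2
      have e3 := abs_le_mul_norm_symbol hc0 hμ k
      have e4 : 0 < ‖Complex.I * c * k - μ‖ :=
        (abs_pos.2 hμ).trans_le (abs_re_le_norm_symbol c μ k)
      rw [norm_mul]
      refine le_of_mul_le_mul_left ?_ e4
      calc _ = |(k : ℝ)| * ‖fourierCoeff (u + mulL2 φ u : L2per) k‖ := by rw [← e2]; ring
        _ ≤ M * ‖Complex.I * c * k - μ‖ * ‖fourierCoeff (u + mulL2 φ u : L2per) k‖ := by gcongr
        _ = _ := by ring
  have sφ : Summable fun k => ‖((1 + absPow α k : ℝ) : ℂ) * coef φ k‖ ^ 2 := by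
    have e1 : Summable fun k : ℤ => (if 1 < |k| then 0 else
        ‖((1 + absPow α k : ℝ) : ℂ) * coef φ k‖ ^ 2) := by
      apply summable_of_ne_finset_zero (s := {-1, 0, 1})
      intro k hk
      by_cases h2 : 1 < |k|
      · simp [h2]
      · rcases eq_of_not_one_lt_abs h2 with h3 | h3 | h3 <;> simp [h3] at hk
    refine (hs.add e1).congr fun k => ?_
    rw [high, norm_mul, Complex.norm_real, Real.norm_eq_abs,
      abs_of_nonneg (add_nonneg zero_le_one (absPow_nonneg α k))]
    split_ifs <;> simp
  have hQ := hasSum_linCoeff_mul_conj hμ h0 hu su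
  have hK := hasSum_constraint hw hg hμ0 h0 hu
  -- `y = u - b φ'` has equal coefficients at the frequencies `1` and `-1`
  set b : ℂ := (fourierCoeff u 1 - fourierCoeff u (-1)) / (2 * Complex.I * coef φ 1) with hb
  set y : L2per := u - b • ofC g with hy
  have hyk : ∀ k, fourierCoeff y k = fourierCoeff u k - b * (Complex.I * k * coef φ k) := by
    intro k
    rw [hy, fourierCoeff_sub', fourierCoeff_smul', ← coef, hgk]
  have y0 : fourierCoeff y 0 = 0 := by
    rw [hyk, h0, hw.coef_zero]
    simp
  have y1 : fourierCoeff y (-1) = fourierCoeff y 1 := by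
    rw [hyk, hyk, hw.coef_neg, hb]
    push_cast
    field_simp
    ring
  have hKy : HasSum (fun k => ((1 + absPow α k : ℝ) : ℂ) * coef φ k * fourierCoeff y k) 0 := by
    have e1 := summable_mul_of_sq sφ (hasSum_norm_sq (ofC g)).summable
    have e2 := e1.hasSum
    rw [tsum_eq_zero_of_odd] at e2
    · have e3 := hK.sub (e2.mul_left b)
      rw [mul_zero, sub_zero] at e3
      refine e3.congr_fun fun k => ?_
      rw [hyk, ← coef, hgk]
      ring
    · intro k
      rw [← coef, ← coef, hgk, hgk, hw.coef_neg, absPow_neg]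
      push_cast
      ring
  have hQy : HasSum (fun k => (starRingEnd ℂ) (fourierCoeff y k) * linCoeff α c φ u k) 0 := by
    have e1 := hQ.add (hK.mul_left ((starRingEnd ℂ) b * μ))
    rw [mul_zero, add_zero] at e1
    refine e1.congr_fun fun k => ?_
    rw [hyk, map_sub, map_mul, map_mul, map_mul, conj_coef_of_even hw.even, Complex.conj_I,
      map_intCast]
    by_cases hk : k = 0
    · subst hk
      simp [h0]
    · linear_combination (-(starRingEnd ℂ) b * coef φ k) * hu k hk
  have hLy : ∀ k : ℤ, k ≠ 0 → linCoeff α c φ u k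
      = ((c * absPow α k + (c - 1) : ℝ) : ℂ) * fourierCoeff y k
        - fourierCoeff (mulL2 φ y) k := by
    intro k hk
    have e1 : fourierCoeff (mulL2 φ y) k
        = fourierCoeff (mulL2 φ u) k - b * (Complex.I * k / 2 * coef (φ * φ) k) := by
      rw [hy, map_sub, map_smul, mulL2_ofC, fourierCoeff_sub', fourierCoeff_smul', ← coef,
        coef_mul_deriv hg]
    rw [linCoeff_of_ne_zero u hk, e1, hyk]
    linear_combination b * Complex.I * k * hw.coef_equation hk
  set q : ℤ → ℝ := fun k => (c * absPow α k + (c - 1)) * ‖fourierCoeff y k‖ ^ 2 with hq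
  set R : ℝ := (inner ℂ y (mulL2 φ y)).re with hR
  have hqR : HasSum q R := by
    have e1 := Complex.hasSum_re (hQy.add (hasSum_inner y (mulL2 φ y)))
    rw [zero_add] at e1
    refine e1.congr_fun fun k => ?_
    by_cases hk : k = 0
    · subst hk
      simp [hq, y0]
    · rw [hLy k hk, ← mul_add, sub_add_cancel, mul_left_comm, ← Complex.normSq_eq_conj_mul_self,
        ← Complex.ofReal_mul, Complex.ofReal_re, Complex.normSq_eq_norm_sq]
  have hRle : R ≤ 1 / 2 * gap α * ‖y‖ ^ 2 := by
    calc R ≤ ‖inner ℂ y (mulL2 φ y)‖ := Complex.re_le_norm _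
      _ ≤ ‖y‖ * ‖mulL2 φ y‖ := norm_inner_le_norm _ _
      _ ≤ ‖y‖ * (1 / 2 * gap α * ‖y‖) := by
          gcongr
          exact (norm_mulL2_le _ _).trans (by gcongr)
      _ = _ := by ring
  have hY := hasSum_high (hasSum_norm_sq y)
  have hqh := hasSum_high hqR
  simp only [hq, y0, y1, absPow_neg, absPow_one, norm_zero] at hY hqh
  have hcoer := hasSum_le (fun k => ?_) (hY.mul_left (2 * gap α)) hqh
  swap
  · simp only [high]
    split_ifs with hk
    · have e1 := gap_mul_le_symbol hα hc hk
      have e2 := (one_lt_two_rpow hα).le.trans (two_rpow_le_absPow hα hk)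
      gcongr
      nlinarith
    · simp
  set Y := ‖y‖ ^ 2 - (‖fourierCoeff y 1‖ ^ 2 + 0 ^ 2 + ‖fourierCoeff y 1‖ ^ 2) with hYdef
  have hsmall : 28 * ‖fourierCoeff y 1‖ ^ 2 ≤ Y := by
    have e1 := hasSum_high hKy
    rw [y0, y1, hw.coef_neg, absPow_neg, absPow_one] at e1
    have e2 := (e1.mul_left ((8 * ‖fourierCoeff y 1‖ * ‖coef φ 1‖ : ℝ) : ℂ)).norm_le_of_bounded
      ((hs.hasSum.mul_left (16 * ‖fourierCoeff y 1‖ ^ 2)).add (hY.mul_left (‖coef φ 1‖ ^ 2)))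
      (fun k => ?_)
    swap
    · rw [norm_mul, Complex.norm_real, Real.norm_eq_abs, abs_of_nonneg (by positivity)]
      simp only [high]
      split_ifs with hk
      · have := absPow_nonneg α k
        rw [norm_mul, norm_mul, Complex.norm_real, Real.norm_eq_abs,
          abs_of_nonneg (by positivity)]
        nlinarith [sq_nonneg (4 * ‖fourierCoeff y 1‖ * ((1 + absPow α k) * ‖coef φ k‖)
          - ‖coef φ 1‖ * ‖fourierCoeff y k‖)]
      · simp
    have e3 : ‖((8 * ‖fourierCoeff y 1‖ * ‖coef φ 1‖ : ℝ) : ℂ) * (0 - (((1 + 1 : ℝ) : ℂ)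
        * coef φ 1 * fourierCoeff y 1 + ((1 + absPow α 0 : ℝ) : ℂ) * coef φ 0 * 0
        + ((1 + 1 : ℝ) : ℂ) * coef φ 1 * fourierCoeff y 1))‖
        = 32 * ‖fourierCoeff y 1‖ ^ 2 * ‖coef φ 1‖ ^ 2 := by
      have e4 : (0 - (((1 + 1 : ℝ) : ℂ)
        * coef φ 1 * fourierCoeff y 1 + ((1 + absPow α 0 : ℝ) : ℂ) * coef φ 0 * 0
        + ((1 + 1 : ℝ) : ℂ) * coef φ 1 * fourierCoeff y 1))
        = ((-4 : ℝ) : ℂ) * (coef φ 1 * fourierCoeff y 1) := by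
        push_cast
        ring
      rw [e4, norm_mul, norm_mul, norm_mul, Complex.norm_real, Complex.norm_real,
        Real.norm_eq_abs, Real.norm_eq_abs, abs_of_nonneg (by positivity)]
      norm_num
      ring
    rw [e3] at e2
    have e4 : 16 * ‖fourierCoeff y 1‖ ^ 2
        * ∑' k, high (fun k => ((1 + absPow α k) * ‖coef φ k‖) ^ 2) k
        ≤ 16 * ‖fourierCoeff y 1‖ ^ 2 * ((1 / 2) ^ 2 * ‖coef φ 1‖ ^ 2) := by gcongr
    have e5 : 0 < ‖coef φ 1‖ ^ 2 := by positivity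
    refine le_of_mul_le_mul_left ?_ e5
    linarith
  have hY0 : ‖y‖ ^ 2 ≤ 0 := by
    have e1 : 0 ≤ (2 * c - 1) * ‖fourierCoeff y 1‖ ^ 2 :=
      mul_nonneg (by linarith) (by positivity)
    have e2 : gap α * (28 * ‖fourierCoeff y 1‖ ^ 2) ≤ gap α * Y := by gcongr
    have e3 : gap α * ‖y‖ ^ 2 = gap α * Y + 2 * (gap α * ‖fourierCoeff y 1‖ ^ 2) := by
      rw [hYdef]
      ring
    have e4 : gap α * ‖y‖ ^ 2 ≤ 0 := by linarith
    exact nonpos_of_mul_nonpos_right e4 hκ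
  have hyz : y = 0 := norm_eq_zero.1 (pow_eq_zero_iff two_ne_zero |>.1
    (le_antisymm hY0 (by positivity)))
  refine ext_fourierCoeff fun k => ?_
  rw [fourierCoeff_zero']
  by_cases hk : k = 0
  · rw [hk, h0]
  · have e1 := hu k hk
    rw [hLy k hk, hyz, map_zero, fourierCoeff_zero', mul_zero, sub_zero, mul_zero] at e1
    have e2 : ((1 + absPow α k : ℝ) : ℂ) ≠ 0 :=
      Complex.ofReal_ne_zero.2 (add_pos_of_pos_of_nonneg one_pos (absPow_nonneg α k)).ne'
    exact ((mul_eq_zero.1 ((mul_eq_zero.1 e1).resolve_left e2)).resolve_left hμ0)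


/-! ### The resolvent -/

/-- The symbol of the compact operator `J (c ∂ₓ - μ)⁻¹`. -/
def compactSymbol (α c : ℝ) (μ : ℂ) (k : ℤ) : ℂ :=
  Complex.I * k / (((1 + absPow α k : ℝ) : ℂ) * (Complex.I * c * k - μ))

lemma symbol_ne_zero (c : ℝ) {μ : ℂ} (hμ : μ.re ≠ 0) (k : ℤ) : Complex.I * c * k - μ ≠ 0 :=
  norm_pos_iff.1 ((abs_pos.2 hμ).trans_le (abs_re_le_norm_symbol c μ k))

lemma one_add_absPow_ne_zero (α : ℝ) (k : ℤ) : ((1 + absPow α k : ℝ) : ℂ) ≠ 0 :=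
  Complex.ofReal_ne_zero.2 (add_pos_of_pos_of_nonneg one_pos (absPow_nonneg α k)).ne'

lemma norm_compactSymbol_le (hc : 0 < c) {μ : ℂ} (hμ : μ.re ≠ 0) (k : ℤ) :
    ‖compactSymbol α c μ k‖ ≤ (1 + ‖μ‖ / |μ.re|) / c * (1 + absPow α k)⁻¹ := by
  have h1 := abs_le_mul_norm_symbol hc hμ k
  have h2 : 0 < ‖Complex.I * c * k - μ‖ := norm_pos_iff.2 (symbol_ne_zero c hμ k)
  have h3 : 0 < 1 + absPow α k := add_pos_of_pos_of_nonneg one_pos (absPow_nonneg α k)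
  rw [compactSymbol, norm_div, norm_mul, norm_mul, Complex.norm_I, one_mul, Complex.norm_intCast,
    Complex.norm_real, Real.norm_eq_abs, abs_of_pos h3, div_le_iff₀ (by positivity)]
  refine h1.trans (le_of_eq ?_)
  field_simp

lemma tendsto_compactSymbol (hα : 0 < α) (hc : 0 < c) {μ : ℂ} (hμ : μ.re ≠ 0) :
    Filter.Tendsto (compactSymbol α c μ) Filter.cofinite (nhds 0) := by
  refine squeeze_zero_norm (norm_compactSymbol_le hc hμ) ?_
  rw [← mul_zero ((1 + ‖μ‖ / |μ.re|) / c)]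
  refine Filter.Tendsto.const_mul _ (Filter.Tendsto.inv_tendsto_atTop ?_)
  refine Filter.tendsto_atTop_add_const_left _ _ ((tendsto_rpow_atTop hα).comp ?_)
  have h := tendsto_norm_cocompact_atTop (E := ℝ) |>.comp Int.tendsto_coe_cofinite
  exact h

/-- Inverting the transport part `c ∂ₓ - μ` turns `J ℒ - μ` into `1 - K` with `K` compact, so by
the Fredholm alternative the absence of eigenfunctions makes `J ℒ - μ` boundedly invertible. -/
theorem mem_resolvent_opJL (hα : 0 < α) (hc : 0 < c) {μ : ℂ} (hμ : μ.re ≠ 0)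
    (heig : ∀ u : L2per, fourierCoeff u 0 = 0 →
      (∀ k : ℤ, k ≠ 0 → ((1 + absPow α k : ℝ) : ℂ) * (μ * fourierCoeff u k)
        = Complex.I * k * linCoeff α c φ u k) → u = 0) :
    μ ∈ resolvent (opJL α c φ) := by
  have hM : 0 ≤ (1 + ‖μ‖ / |μ.re|) / c := by positivity
  have hm : ∀ k, ‖compactSymbol α c μ k‖ ≤ (1 + ‖μ‖ / |μ.re|) / c := fun k =>
    (norm_compactSymbol_le hc hμ k).trans (mul_le_of_le_one_right hM
      (inv_le_one_of_one_le₀ (le_add_of_nonneg_right (absPow_nonneg α k))))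
  have hn : ∀ k : ℤ, ‖(Complex.I * c * k - μ)⁻¹‖ ≤ |μ.re|⁻¹ := by
    intro k
    rw [norm_inv]
    exact inv_anti₀ (abs_pos.2 hμ) (abs_re_le_norm_symbol c μ k)
  set N : L2per →L[ℂ] L2per := diagL2 _ (by positivity) hn with hN
  set K : L2per →L[ℂ] L2per := diagL2 _ hM hm ∘L (1 + mulL2 φ) with hK
  have hNk : ∀ u k, fourierCoeff (N u) k = (Complex.I * c * k - μ)⁻¹ * fourierCoeff u k :=
    fun u k => fourierCoeff_diagL2 _ _ _ u k
  have hKk : ∀ u k, fourierCoeff (K u) k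
      = compactSymbol α c μ k * (fourierCoeff u k + fourierCoeff (mulL2 φ u) k) := by
    intro u k
    rw [hK, ContinuousLinearMap.comp_apply, fourierCoeff_diagL2, add_apply, fourierCoeff_add']
    rfl
  have hKc : IsCompactOperator K :=
    (isCompactOperator_diagL2 _ hM hm (tendsto_compactSymbol hα hc hμ)).comp_clm _
  -- the equation `J ℒ u - μ u = f` in the form `u - K u = N f`
  have key : ∀ u f : L2per, fourierCoeff f 0 = 0 →
      (u - K u = N f ↔ fourierCoeff u 0 = 0 ∧ ∀ k : ℤ, k ≠ 0 →
        ((1 + absPow α k : ℝ) : ℂ) * (fourierCoeff f k + μ * fourierCoeff u k)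
          = Complex.I * k * linCoeff α c φ u k) := by
    intro u f hf
    have e1 : ∀ k : ℤ, k ≠ 0 → (fourierCoeff (u - K u : L2per) k = fourierCoeff (N f) k ↔
        ((1 + absPow α k : ℝ) : ℂ) * (fourierCoeff f k + μ * fourierCoeff u k)
          = Complex.I * k * linCoeff α c φ u k) := by
      intro k hk
      have s1 := symbol_ne_zero c hμ k
      have s2 := one_add_absPow_ne_zero α k
      rw [fourierCoeff_sub', hKk, hNk, linCoeff_of_ne_zero u hk, compactSymbol]
      obtain ⟨s, hs⟩ : ∃ s, s = Complex.I * c * k - μ := ⟨_, rfl⟩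
      rw [← hs] at s1 ⊢
      rw [div_mul_eq_mul_div, inv_mul_eq_div, eq_div_iff s1, sub_mul, div_mul_eq_mul_div,
        mul_div_mul_right _ _ s1, ← mul_right_inj' s2, mul_sub, mul_div_cancel₀ _ s2]
      push_cast
      constructor <;> intro h <;> linear_combination
        -h + (1 + (absPow α k : ℂ)) * fourierCoeff u k * hs
    have e2 : fourierCoeff (u - K u : L2per) 0 = fourierCoeff u 0 := by
      rw [fourierCoeff_sub', hKk, compactSymbol]
      simp
    have e3 : fourierCoeff (N f) 0 = 0 := by rw [hNk, hf, mul_zero]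
    constructor
    · intro h
      refine ⟨?_, fun k hk => (e1 k hk).1 (by rw [h])⟩
      rw [← e2, h, e3]
    · rintro ⟨h1, h2⟩
      refine ext_fourierCoeff fun k => ?_
      by_cases hk : k = 0
      · rw [hk, e2, e3, h1]
      · exact (e1 k hk).2 (h2 k hk)
  have hinv : IsUnit (1 - K) := by
    have h1 := hKc.hasEigenvalue_or_mem_resolventSet one_ne_zero
    rcases h1 with h1 | h1
    · exfalso
      obtain ⟨u, hu⟩ := h1.exists_hasEigenvector
      have h2 : K u = u := by simpa using hu.apply_eq_smul
      have h3 := (key u 0 (fourierCoeff_zero' 0)).1 (by rw [h2, sub_self, map_zero])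
      refine hu.2 (heig u h3.1 fun k hk => ?_)
      have h4 := h3.2 k hk
      rwa [fourierCoeff_zero', zero_add] at h4
    · simpa [spectrum.mem_resolventSet_iff] using h1
  obtain ⟨U, hU⟩ := hinv
  set A : L2per →L[ℂ] L2per := ((U⁻¹ : (L2per →L[ℂ] L2per)ˣ) : L2per →L[ℂ] L2per) with hA
  have hA1 : ∀ v, A v - K (A v) = v := by
    intro v
    have := congrArg (fun T : L2per →L[ℂ] L2per => T v) U.mul_inv
    rw [hU] at this
    simpa using this
  have hA2 : ∀ v, A (v - K v) = v := by
    intro v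
    have := congrArg (fun T : L2per →L[ℂ] L2per => T v) U.inv_mul
    rw [hU] at this
    simpa using this
  have hX : ∀ f : X0, fourierCoeff (f : L2per) 0 = 0 := fun f => (mem_X0_iff _).1 f.2
  have hRf : ∀ f : X0, A (N f) ∈ X0 := fun f =>
    (mem_X0_iff _).2 ((key _ _ (hX f)).1 (hA1 (N f))).1
  have hgraph : ∀ u w : X0, (u, w) ∈ (opJL α c φ).graph ↔
      (u : L2per) - K u = N ((w : L2per) - μ • (u : L2per)) := by
    intro u w
    rw [mem_graph_opJL, key _ _ (by rw [fourierCoeff_sub', fourierCoeff_smul', hX, hX]; simp)]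
    simp only [fourierCoeff_sub', fourierCoeff_smul', sub_add_cancel, hX, true_and]
    refine ⟨fun h k _ => h k, fun h k => ?_⟩
    by_cases hk : k = 0
    · rw [hk, hX]
      simp
    · exact h k hk
  refine ⟨((A ∘L N) ∘L X0.subtypeL).codRestrict X0 hRf, fun f => ?_, fun u => ?_⟩
  · set v : X0 := ((A ∘L N) ∘L X0.subtypeL).codRestrict X0 hRf f with hv
    have h1 : (v, f + μ • v) ∈ (opJL α c φ).graph := by
      rw [hgraph]
      have h2 : ((f + μ • v : X0) : L2per) - μ • (v : L2per) = f := by simp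
      rw [h2]
      exact hA1 (N f)
    have h2 : v ∈ (opJL α c φ).domain := LinearPMap.mem_domain_of_mem_graph h1
    refine ⟨h2, ?_⟩
    rw [← (LinearPMap.image_iff h2).2 h1, add_sub_cancel_right]
  · have h1 := (hgraph _ _).1 ((opJL α c φ).mem_graph u)
    apply Subtype.ext
    change A (N ((opJL α c φ u - μ • (u : X0) : X0) : L2per)) = ((u : X0) : L2per)
    rw [Submodule.coe_sub, Submodule.coe_smul, ← h1, hA2]

/-- Small even waves of speed `c ≥ 1/2` are spectrally stable. -/
theorem IsEvenWave.spectrallyStable (hα : 0 < α) (hw : IsEvenWave α c φ)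
    (hc : |c - 1 / 2| ≤ gap α) (hc' : 1 / 2 ≤ c) (nφ : ‖φ‖ ≤ 1 / 2 * gap α)
    (h1 : coef φ 1 ≠ 0) : SpectrallyStable α c φ := by
  intro μ hμ
  by_contra h
  exact hμ (mem_resolvent_opJL hα (by linarith) h fun u h0 hu =>
    hw.eigenfunction_eq_zero hα hc hc' nφ h1 h h0 hu)

end Stability

/-! ### A weighted Wiener algebra -/

/-- The Banach space `ℓ¹(ℤ)`. Its element `x` stands for the Fourier series
`∑ 2^{-|k|} x_k e^{ikt}`. -/
abbrev Wien : Type := lp (fun _ : ℤ => ℝ) 1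

/-- The `k`-th unit vector. -/
def unit (k : ℤ) : Wien := lp.single 1 k 1

lemma unit_apply (k j : ℤ) : unit k j = if j = k then 1 else 0 := by
  rw [unit, lp.single_apply, Pi.single_apply]

lemma norm_unit (k : ℤ) : ‖unit k‖ = 1 := by
  rw [unit, lp.norm_single one_pos, norm_one]

lemma norm_apply_le (x : Wien) (k : ℤ) : |x k| ≤ ‖x‖ :=
  lp.norm_apply_le_norm one_ne_zero x k

lemma wien_ext {F : Type*} [NormedAddCommGroup F] [NormedSpace ℝ F] {S T : Wien →L[ℝ] F}
    (h : ∀ k, S (unit k) = T (unit k)) : S = T := by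
  refine lp.ext_continuousLinearMap ENNReal.one_ne_top fun k => ?_
  ext
  exact h k

/-- The bounded linear map on `ℓ¹(ℤ)` with prescribed bounded values on the unit vectors. -/
def lift {F : Type*} [NormedAddCommGroup F] [NormedSpace ℝ F] [CompleteSpace F] (f : ℤ → F)
    {K : ℝ} (hK : 0 ≤ K) (hf : ∀ k, ‖f k‖ ≤ K) : Wien →L[ℝ] F :=
  lp.tsumCLM ℝ ℤ F ∘L
    lp.mapCLM 1 (fun k => ContinuousLinearMap.toSpanSingleton ℝ (f k)) hK
      (fun k => by simpa using hf k)

section Lift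

variable {F : Type*} [NormedAddCommGroup F] [NormedSpace ℝ F] [CompleteSpace F] (f : ℤ → F)
  {K : ℝ} (hK : 0 ≤ K) (hf : ∀ k, ‖f k‖ ≤ K)

lemma lift_apply (x : Wien) : lift f hK hf x = ∑' k, x k • f k := by
  simp [lift]

lemma lift_unit (k : ℤ) : lift f hK hf (unit k) = f k := by
  rw [lift_apply, tsum_eq_single k]
  · rw [unit_apply, if_pos rfl, one_smul]
  · intro j hj
    rw [unit_apply, if_neg hj, zero_smul]

lemma norm_lift_le : ‖lift f hK hf‖ ≤ K := by
  refine (ContinuousLinearMap.opNorm_comp_le _ _).trans ?_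
  calc _ ≤ 1 * K := by
        gcongr
        · exact lp.norm_tsumCLM_le
        · exact lp.norm_mapCLM_le _ _ _ _
    _ = K := one_mul K

end Lift

/-- The weight `2^{|j + l| - |j| - |l|} ≤ 1` in the product of two series. -/
def weight (j l : ℤ) : ℝ := 2 ^ (|j + l| - |j| - |l|)

lemma norm_weight_smul_le (j l : ℤ) : ‖weight j l • unit (j + l)‖ ≤ 1 := by
  rw [norm_smul, norm_unit, mul_one, weight, norm_zpow, Real.norm_ofNat]
  refine zpow_le_one_of_nonpos₀ (by norm_num) ?_
  have := abs_add_le j l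
  omega

/-- The product of two series. -/
def conv : Wien →L[ℝ] Wien →L[ℝ] Wien :=
  lift (fun j => lift (fun l => weight j l • unit (j + l)) zero_le_one (norm_weight_smul_le j))
    zero_le_one (fun _ => norm_lift_le _ _ _)

lemma conv_unit_unit (j l : ℤ) : conv (unit j) (unit l) = weight j l • unit (j + l) := by
  rw [conv, lift_unit, lift_unit]

lemma norm_conv_le (x y : Wien) : ‖conv x y‖ ≤ ‖x‖ * ‖y‖ := by
  refine (conv.le_opNorm₂ x y).trans ?_
  have h : ‖conv‖ ≤ 1 := norm_lift_le _ _ _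
  calc _ ≤ 1 * ‖x‖ * ‖y‖ := by gcongr
    _ = _ := by ring

lemma bilin_ext {F : Type*} [NormedAddCommGroup F] [NormedSpace ℝ F]
    {S T : Wien →L[ℝ] Wien →L[ℝ] F} (h : ∀ j l, S (unit j) (unit l) = T (unit j) (unit l)) :
    S = T :=
  wien_ext fun j => wien_ext fun l => h j l

lemma conv_comm (x y : Wien) : conv x y = conv y x := by
  have h : conv = conv.flip := bilin_ext fun j l => by
    rw [ContinuousLinearMap.flip_apply, conv_unit_unit, conv_unit_unit, weight, weight, add_comm]
    congr 2
    ring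
  calc conv x y = conv.flip x y := by rw [← h]
    _ = conv y x := rfl

lemma conv_unit_apply (j k : ℤ) (y : Wien) : conv (unit j) y k = weight j (k - j) * y (k - j) := by
  have h : lp.evalCLM ℝ (fun _ : ℤ => ℝ) 1 k ∘L conv (unit j)
      = weight j (k - j) • lp.evalCLM ℝ (fun _ : ℤ => ℝ) 1 (k - j) := by
    refine wien_ext fun l => ?_
    change conv (unit j) (unit l) k = weight j (k - j) * unit l (k - j)
    rw [conv_unit_unit, lp.coeFn_smul, Pi.smul_apply, unit_apply, unit_apply, smul_eq_mul]
    by_cases hk : k = j + l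
    · subst hk
      simp
    · rw [if_neg hk, if_neg (fun h => hk (by rw [← h]; ring))]
      simp
  exact DFunLike.congr_fun h y

/-- The reflection `k ↦ -k`. -/
def refl : Wien →L[ℝ] Wien := lift (fun k => unit (-k)) zero_le_one fun _ => (norm_unit _).le

lemma refl_unit (k : ℤ) : refl (unit k) = unit (-k) := lift_unit _ _ _ k

lemma refl_apply (x : Wien) (k : ℤ) : refl x k = x (-k) := by
  have h : lp.evalCLM ℝ (fun _ : ℤ => ℝ) 1 k ∘L refl = lp.evalCLM ℝ (fun _ : ℤ => ℝ) 1 (-k) := by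
    refine wien_ext fun l => ?_
    change refl (unit l) k = unit l (-k)
    rw [refl_unit, unit_apply, unit_apply]
    simp only [neg_eq_iff_eq_neg]
  exact DFunLike.congr_fun h x

lemma refl_conv (x y : Wien) : refl (conv x y) = conv (refl x) (refl y) := by
  have h : (ContinuousLinearMap.compL ℝ Wien Wien Wien refl) ∘L conv
      = conv.bilinearComp refl refl := bilin_ext fun j l => by
    change refl (conv (unit j) (unit l)) = conv (refl (unit j)) (refl (unit l))
    rw [conv_unit_unit, refl_unit, refl_unit, conv_unit_unit, map_smul, refl_unit, weight, weight,
      abs_neg, abs_neg, ← neg_add, abs_neg]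
  calc refl (conv x y) = ((ContinuousLinearMap.compL ℝ Wien Wien Wien refl) ∘L conv) x y := rfl
    _ = _ := by rw [h]; rfl

/-! ### From sequences to functions -/

lemma norm_weight_fourier (k : ℤ) :
    ‖((2 : ℝ) ^ (-|k|)) • (fourier k : C(Circ, ℂ))‖ ≤ 1 := by
  rw [norm_smul, fourier_norm, mul_one, norm_zpow, Real.norm_ofNat]
  exact zpow_le_one_of_nonpos₀ (by norm_num) (by simp)

/-- The sum of the Fourier series `∑ 2^{-|k|} x_k e^{ikt}`. -/
def series : Wien →L[ℝ] C(Circ, ℂ) :=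
  lift (fun k => ((2 : ℝ) ^ (-|k|)) • fourier k) zero_le_one norm_weight_fourier

lemma series_unit (k : ℤ) : series (unit k) = ((2 : ℝ) ^ (-|k|)) • fourier k := lift_unit _ _ _ k

lemma norm_series_le (x : Wien) : ‖series x‖ ≤ ‖x‖ := by
  refine (series.le_of_opNorm_le (norm_lift_le _ _ _) x).trans (le_of_eq (one_mul _))

lemma series_conv (x y : Wien) : series (conv x y) = series x * series y := by
  have h : (ContinuousLinearMap.compL ℝ Wien Wien C(Circ, ℂ) series) ∘L conv
      = (ContinuousLinearMap.mul ℝ C(Circ, ℂ)).bilinearComp series series := bilin_ext fun j l => by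
    change series (conv (unit j) (unit l)) = series (unit j) * series (unit l)
    rw [conv_unit_unit, map_smul, series_unit, series_unit, series_unit, smul_smul, weight,
      ← zpow_add₀ two_ne_zero, smul_mul_smul_comm, ← zpow_add₀ two_ne_zero]
    congr 1
    · congr 1
      ring
    · ext t
      rw [fourier_add]
      rfl
  calc series (conv x y)
      = ((ContinuousLinearMap.compL ℝ Wien Wien C(Circ, ℂ) series) ∘L conv) x y := rfl
    _ = _ := by rw [h]; rfl

lemma fourierCoeff_series (x : Wien) (k : ℤ) :
    fourierCoeff (series x) k = ((2 ^ (-|k|) * x k : ℝ) : ℂ) := by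
  let T : C(Circ, ℂ) →L[ℂ] ℂ := lp.evalCLM ℂ (fun _ : ℤ => ℂ) 2 k ∘L
    ((fourierBasis (T := 2 * π)).repr.toContinuousLinearEquiv : L2per →L[ℂ] _) ∘L
    (ContinuousMap.toLp (E := ℂ) 2 AddCircle.haarAddCircle ℂ)
  have hT : ∀ f, T f = fourierCoeff f k := by
    intro f
    rw [← fourierCoeff_toLp, ← fourierBasis_repr]
    rfl
  have h : T.restrictScalars ℝ ∘L series
      = (2 : ℝ) ^ (-|k|) • (Complex.ofRealCLM ∘L lp.evalCLM ℝ (fun _ : ℤ => ℝ) 1 k) := by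
    refine wien_ext fun l => ?_
    change T (series (unit l)) = ((2 : ℝ) ^ (-|k|)) • ((unit l k : ℝ) : ℂ)
    rw [series_unit, ← Complex.coe_smul, map_smul, hT, fourierCoeff_fourier, Pi.single_apply,
      unit_apply]
    by_cases hk : k = l
    · subst hk
      simp
    · simp [hk]
  have h2 := DFunLike.congr_fun h x
  rw [← hT]
  refine h2.trans ?_
  change ((2 : ℝ) ^ (-|k|)) • ((x k : ℝ) : ℂ) = _
  rw [Complex.real_smul, Complex.ofReal_mul]

lemma series_refl (x : Wien) (t : Circ) :
    series (refl x) t = (starRingEnd ℂ) (series x t) ∧ series (refl x) t = series x (-t) := by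
  let ev : Circ → (C(Circ, ℂ) →L[ℝ] ℂ) := fun t => ContinuousMap.evalCLM ℝ t
  have hs : ∀ (k : ℤ) (t : Circ), series (unit k) t = ((2 : ℝ) ^ (-|k|) : ℝ) * fourier k t := by
    intro k t
    rw [series_unit]
    exact Complex.real_smul
  constructor
  · have h : ev t ∘L series ∘L refl = (Complex.conjCLE : ℂ →L[ℝ] ℂ) ∘L ev t ∘L series := by
      refine wien_ext fun k => ?_
      change series (refl (unit k)) t = (starRingEnd ℂ) (series (unit k) t)
      rw [refl_unit, hs, hs, map_mul, Complex.conj_ofReal, abs_neg, fourier_neg]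
    exact DFunLike.congr_fun h x
  · have h : ev t ∘L series ∘L refl = ev (-t) ∘L series := by
      refine wien_ext fun k => ?_
      change series (refl (unit k)) t = series (unit k) (-t)
      rw [refl_unit, hs, hs, abs_neg, fourier_apply, fourier_apply, smul_neg, neg_smul]
    exact DFunLike.congr_fun h x

lemma iteratedDeriv_fourier (k : ℤ) (n : ℕ) :
    iteratedDeriv n (fun t : ℝ => (fourier k (t : Circ) : ℂ))
      = fun t : ℝ => (Complex.I * k) ^ n * fourier k (t : Circ) := by
  induction n with
  | zero => simp
  | succ n ih =>
    funext t
    rw [iteratedDeriv_succ, ih]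
    refine ((hasDerivAt_fourier_circ k t).const_mul _).deriv.trans ?_
    ring

lemma exists_pow_mul_le (n : ℕ) : ∃ C : ℝ, ∀ k : ℤ, |(k : ℝ)| ^ n * 2 ^ (-|k|) ≤ C := by
  have h := tendsto_pow_const_mul_const_pow_of_abs_lt_one n (r := 1 / 2)
    (by rw [abs_of_pos] <;> norm_num)
  obtain ⟨C, hC⟩ := h.bddAbove_range
  refine ⟨C, fun k => ?_⟩
  have h1 := hC ⟨k.natAbs, rfl⟩
  refine le_trans (le_of_eq ?_) h1
  simp only [Nat.cast_natAbs, Int.cast_abs]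
  rw [zpow_neg, Int.abs_eq_natAbs, zpow_natCast, one_div, inv_pow]

/-- The coefficients `2^{-|k|} x_k` decay exponentially, so their series is smooth. -/
lemma contDiff_series (x : Wien) : ContDiff ℝ ∞ (fun t : ℝ => series x (t : Circ)) := by
  choose C hC using exists_pow_mul_le
  have hx : Summable fun k => |x k| := by
    have := (lp.memℓp x).summable (by norm_num)
    simpa using this
  have h1 : (fun t : ℝ => series x (t : Circ))
      = fun t : ℝ => ∑' k : ℤ, ((x k * 2 ^ (-|k|) : ℝ) : ℂ) * fourier k (t : Circ) := by
    funext t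
    have h2 : Summable fun k => x k • (((2 : ℝ) ^ (-|k|)) • (fourier k : C(Circ, ℂ))) := by
      refine Summable.of_norm_bounded hx fun k => ?_
      rw [norm_smul]
      exact mul_le_of_le_one_right (norm_nonneg _) (norm_weight_fourier k)
    have h3 := (ContinuousMap.evalCLM ℝ (t : Circ) : C(Circ, ℂ) →L[ℝ] ℂ).map_tsum h2
    rw [series, lift_apply]
    refine h3.trans ?_
    congr 1
    funext k
    change x k • ((2 : ℝ) ^ (-|k|) • fourier k (t : Circ)) = _
    rw [smul_smul, Complex.real_smul]
  have hf : ∀ k : ℤ, ContDiff ℝ ∞ fun t : ℝ => (fourier k (t : Circ) : ℂ) := by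
    intro k
    have : (fun t : ℝ => (fourier k (t : Circ) : ℂ))
        = fun t : ℝ => Complex.exp (2 * π * Complex.I * k * t / (2 * π : ℝ)) := by
      funext t
      exact fourier_coe_apply
    rw [this]
    exact ((contDiff_const.mul Complex.ofRealCLM.contDiff).div_const _).cexp
  rw [h1]
  refine contDiff_tsum (v := fun n k => C n * |x k|) (fun k => contDiff_const.mul (hf k))
    (fun n _ => hx.mul_left _) (fun n k t _ => ?_)
  rw [norm_iteratedFDeriv_eq_norm_iteratedDeriv]
  have h2 : iteratedDeriv n (fun t : ℝ => ((x k * 2 ^ (-|k|) : ℝ) : ℂ) * fourier k (t : Circ)) t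
      = ((x k * 2 ^ (-|k|) : ℝ) : ℂ) * ((Complex.I * k) ^ n * fourier k (t : Circ)) := by
    rw [iteratedDeriv_const_mul_field, iteratedDeriv_fourier]
  rw [h2, norm_mul, norm_mul, norm_pow, norm_mul, Complex.norm_I, one_mul, Complex.norm_intCast,
    Complex.norm_real, fourier_apply, Circle.norm_coe, mul_one, norm_mul, Real.norm_eq_abs,
    Real.norm_of_nonneg (by positivity)]
  calc |x k| * 2 ^ (-|k|) * |(k : ℝ)| ^ n = |(k : ℝ)| ^ n * 2 ^ (-|k|) * |x k| := by ring
    _ ≤ _ := by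
      gcongr
      exact hC n k

/-- The real part of the sum of a series. -/
def realSeries (x : Wien) : C(Circ, ℝ) :=
  ⟨fun t => (series x t).re, Complex.continuous_re.comp (series x).continuous⟩

lemma ofReal_realSeries {x : Wien} (hx : refl x = x) (t : Circ) :
    ((realSeries x t : ℝ) : ℂ) = series x t := by
  have h := (series_refl x t).1
  rw [hx] at h
  exact Complex.conj_eq_iff_re.1 h.symm

lemma coef_realSeries {x : Wien} (hx : refl x = x) (k : ℤ) :
    coef (realSeries x) k = ((2 ^ (-|k|) * x k : ℝ) : ℂ) := by
  rw [coef_eq, ← fourierCoeff_series]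
  congr 1
  funext t
  exact ofReal_realSeries hx t

lemma realSeries_even {x : Wien} (hx : refl x = x) (t : Circ) :
    realSeries x (-t) = realSeries x t := by
  change (series x (-t)).re = (series x t).re
  rw [← (series_refl x t).2, hx]

lemma realSeries_mul {x y : Wien} (hx : refl x = x) (hy : refl y = y) :
    realSeries x * realSeries y = realSeries (conv x y) := by
  have hxy : refl (conv x y) = conv x y := by rw [refl_conv, hx, hy]
  ext t
  apply Complex.ofReal_injective
  rw [ofReal_realSeries hxy, series_conv, ContinuousMap.mul_apply, ContinuousMap.mul_apply,
    Complex.ofReal_mul, ofReal_realSeries hx, ofReal_realSeries hy]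

lemma abs_realSeries_le (x : Wien) (t : Circ) : |realSeries x t| ≤ ‖x‖ :=
  (Complex.abs_re_le_norm _).trans (((series x).norm_coe_le_norm t).trans (norm_series_le x))

lemma norm_realSeries_le (x : Wien) : ‖realSeries x‖ ≤ ‖x‖ :=
  (ContinuousMap.norm_le _ (norm_nonneg _)).2 fun t => abs_realSeries_le x t

lemma contDiff_realSeries (x : Wien) :
    ContDiff ℝ ∞ (fun t : ℝ => realSeries x (t : Circ)) :=
  Complex.reCLM.contDiff.comp (contDiff_series x)

lemma realSeries_unit_add_unit_neg (k : ℤ) (t : ℝ) :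
    realSeries (unit k + unit (-k)) (t : Circ) = 2 * 2 ^ (-|k|) * Real.cos (k * t) := by
  change (series (unit k + unit (-k)) (t : Circ)).re = _
  rw [map_add, series_unit, series_unit, abs_neg, ← smul_add]
  have h : (fourier k (t : Circ) : ℂ) = Complex.exp ((k * t : ℝ) * Complex.I) := by
    rw [fourier_coe_apply]
    congr 1
    have : (π : ℂ) ≠ 0 := Complex.ofReal_ne_zero.2 Real.pi_ne_zero
    push_cast
    field_simp
  change ((2 : ℝ) ^ (-|k|) • (fourier k (t : Circ) + fourier (-k) (t : Circ) : ℂ)).re = _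
  rw [fourier_neg, Complex.add_conj, h, Complex.exp_ofReal_mul_I_re, Complex.real_smul,
    ← Complex.ofReal_mul, Complex.ofReal_re]
  ring

/-! ### The bifurcation equation -/

/-- The symbol of `(2 (c D^α + c - 1))⁻¹`, `c = 1/2 + γ`, on the frequencies `|k| ≥ 2`. -/
def invSymbol (α γ : ℝ) : ℤ → ℝ :=
  high fun k => (2 * ((1 / 2 + γ) * absPow α k + (1 / 2 + γ - 1)))⁻¹

section InvSymbol

variable {α γ δ : ℝ}

lemma gap_mul_le_symbol' (hα : 0 < α) (hγ : |γ| ≤ gap α) {k : ℤ} (hk : 1 < |k|) :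
    gap α * (1 + absPow α k) ≤ (1 / 2 + γ) * absPow α k + (1 / 2 + γ - 1) :=
  gap_mul_le_symbol hα (by rwa [add_sub_cancel_left]) hk

lemma norm_invSymbol_le (hα : 0 < α) (hγ : |γ| ≤ gap α) (k : ℤ) :
    ‖invSymbol α γ k‖ ≤ 1 / (2 * gap α) := by
  have hκ := gap_pos hα
  rw [invSymbol, high]
  split_ifs with hk
  · have h1 := gap_mul_le_symbol' hα hγ hk
    have h2 := absPow_nonneg α k
    have h3 : gap α ≤ (1 / 2 + γ) * absPow α k + (1 / 2 + γ - 1) := by nlinarith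
    rw [norm_inv, Real.norm_of_nonneg (by linarith), inv_eq_one_div]
    exact one_div_le_one_div_of_le (by positivity) (by linarith)
  · simp only [norm_zero]
    positivity

lemma abs_invSymbol_sub_le (hα : 0 < α) (hγ : |γ| ≤ gap α) (hδ : |δ| ≤ gap α) (k : ℤ) :
    ‖invSymbol α γ k - invSymbol α δ k‖ ≤ 1 / (2 * gap α ^ 2) * |γ - δ| := by
  have hκ := gap_pos hα
  rw [invSymbol, invSymbol, high, high]
  split_ifs with hk
  · have h1 := gap_mul_le_symbol' hα hγ hk
    have h2 := gap_mul_le_symbol' hα hδ hk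
    have h3 := absPow_nonneg α k
    set t := absPow α k
    set A := (1 / 2 + γ) * t + (1 / 2 + γ - 1) with hA
    set A' := (1 / 2 + δ) * t + (1 / 2 + δ - 1) with hA'
    have h4 : 0 < gap α * (1 + t) := by positivity
    have hA0 : 0 < A := h4.trans_le h1
    have hA'0 : 0 < A' := h4.trans_le h2
    have h5 : (2 * A)⁻¹ - (2 * A')⁻¹ = (δ - γ) * (1 + t) / (2 * A * A') := by
      field_simp
      rw [hA, hA']
      ring
    rw [h5, norm_div, norm_mul, Real.norm_of_nonneg (by positivity : 0 ≤ 1 + t),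
      Real.norm_of_nonneg (by positivity : 0 ≤ 2 * A * A'), Real.norm_eq_abs, abs_sub_comm,
      div_le_iff₀ (by positivity)]
    calc |γ - δ| * (1 + t) ≤ |γ - δ| * (1 + t) ^ 2 := by
          gcongr
          nlinarith
      _ = 1 / (2 * gap α ^ 2) * |γ - δ| * (2 * (gap α * (1 + t)) * (gap α * (1 + t))) := by
          field_simp
      _ ≤ _ := by gcongr
  · simp only [sub_zero, norm_zero]
    positivity

/-- The operator `(2 (c D^α + c - 1))⁻¹`, `c = 1/2 + γ`, on the frequencies `|k| ≥ 2`. It is set to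
zero when `γ` is too large for the symbol to be invertible. -/
def invOp (α γ : ℝ) : Wien →L[ℝ] Wien :=
  if h : 0 < α ∧ |γ| ≤ gap α then
    lp.mapCLM 1 (fun k => invSymbol α γ k • ContinuousLinearMap.id ℝ ℝ)
      (K := 1 / (2 * gap α)) (by have := gap_pos h.1; positivity)
      (fun k => by simpa [norm_smul] using norm_invSymbol_le h.1 h.2 k)
  else 0

lemma invOp_apply (hα : 0 < α) (hγ : |γ| ≤ gap α) (x : Wien) (k : ℤ) :
    invOp α γ x k = invSymbol α γ k * x k := by
  rw [invOp, dif_pos ⟨hα, hγ⟩]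
  simp

lemma norm_le_of_forall_abs_le {x y : Wien} {K : ℝ}
    (h : ∀ k, |x k| ≤ K * |y k|) : ‖x‖ ≤ K * ‖y‖ := by
  have e : ∀ z : Wien, HasSum (fun k => |z k|) ‖z‖ := by
    intro z
    have := lp.hasSum_norm (p := 1) (by norm_num) z
    simpa using this
  exact hasSum_le h (e x) ((e y).mul_left K)

lemma norm_invOp_le (hα : 0 < α) (hγ : |γ| ≤ gap α) (x : Wien) :
    ‖invOp α γ x‖ ≤ 1 / (2 * gap α) * ‖x‖ := by
  have hκ := gap_pos hα
  refine norm_le_of_forall_abs_le fun k => ?_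
  rw [invOp_apply hα hγ, abs_mul]
  gcongr
  exact norm_invSymbol_le hα hγ k

lemma norm_invOp_sub_le (hα : 0 < α) (hγ : |γ| ≤ gap α) (hδ : |δ| ≤ gap α) (x : Wien) :
    ‖invOp α γ x - invOp α δ x‖ ≤ 1 / (2 * gap α ^ 2) * |γ - δ| * ‖x‖ := by
  have hκ := gap_pos hα
  refine norm_le_of_forall_abs_le fun k => ?_
  rw [lp.coeFn_sub, Pi.sub_apply, invOp_apply hα hγ, invOp_apply hα hδ, ← sub_mul, abs_mul]
  gcongr
  exact abs_invSymbol_sub_le hα hγ hδ k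

lemma refl_invOp (hα : 0 < α) (hγ : |γ| ≤ gap α) (x : Wien) :
    refl (invOp α γ x) = invOp α γ (refl x) := by
  ext k
  rw [refl_apply, invOp_apply hα hγ, invOp_apply hα hγ, refl_apply, invSymbol, high, high,
    abs_neg, absPow_neg]

end InvSymbol

/-- The sequence of `cos`. -/
def cosSeq : Wien := unit 1 + unit (-1)

lemma refl_cosSeq : refl cosSeq = cosSeq := by
  rw [cosSeq, map_add, refl_unit, refl_unit, neg_neg, add_comm]

lemma norm_cosSeq_le : ‖cosSeq‖ ≤ 2 := by
  refine (norm_add_le _ _).trans ?_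
  rw [norm_unit, norm_unit]
  norm_num

/-- The sequence of `(cos + v)²`, where `x` is the sequence of `v`. -/
def sq (x : Wien) : Wien := conv (cosSeq + x) (cosSeq + x)

lemma refl_sq {x : Wien} (hx : refl x = x) : refl (sq x) = sq x := by
  rw [sq, refl_conv, map_add, hx, refl_cosSeq]

lemma norm_cosSeq_add_le {x : Wien} (hx : ‖x‖ ≤ 1) : ‖cosSeq + x‖ ≤ 3 :=
  (norm_add_le _ _).trans (by linarith [norm_cosSeq_le])

lemma norm_sq_le {x : Wien} (hx : ‖x‖ ≤ 1) : ‖sq x‖ ≤ 9 := by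
  refine (norm_conv_le _ _).trans ?_
  have := norm_cosSeq_add_le hx
  nlinarith [norm_nonneg (cosSeq + x)]

lemma norm_sq_sub_le {x y : Wien} (hx : ‖x‖ ≤ 1) (hy : ‖y‖ ≤ 1) :
    ‖sq x - sq y‖ ≤ 6 * ‖x - y‖ := by
  have h : sq x - sq y = conv (x - y) (cosSeq + x) + conv (cosSeq + y) (x - y) := by
    have h1 : x - y = (cosSeq + x) - (cosSeq + y) := by abel
    rw [sq, sq, h1, map_sub, map_sub, sub_apply]
    abel
  rw [h]
  refine (norm_add_le _ _).trans ?_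
  have h1 := norm_conv_le (x - y) (cosSeq + x)
  have h2 := norm_conv_le (cosSeq + y) (x - y)
  have h3 := norm_cosSeq_add_le hx
  have h4 := norm_cosSeq_add_le hy
  have h5 : ‖x - y‖ * ‖cosSeq + x‖ ≤ ‖x - y‖ * 3 := by gcongr
  have h6 : ‖cosSeq + y‖ * ‖x - y‖ ≤ 3 * ‖x - y‖ := by gcongr
  linarith

/-- The value of `c - 1/2` which solves the equation at the frequency `1` for `a (cos + v)`, where
`x` is the sequence of `v`. -/
def speedShift (a : ℝ) (x : Wien) : ℝ := a / 4 * sq x 1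

/-- The map whose fixed points are the sequences of those `v` for which `a (cos + v)` solves the
equation at the frequencies `|k| ≥ 2`. -/
def waveMap (α a : ℝ) (x : Wien) : Wien := a • invOp α (speedShift a x) (sq x)

section Wave

variable {α a : ℝ}

lemma abs_speedShift_le (ha : 0 ≤ a) {x : Wien} (hx : ‖x‖ ≤ 1) :
    |speedShift a x| ≤ 9 / 4 * a := by
  rw [speedShift, abs_mul, abs_of_nonneg (by positivity)]
  have := (norm_apply_le (sq x) 1).trans (norm_sq_le hx)
  nlinarith

lemma abs_speedShift_le_gap (ha : 0 ≤ a) (ha' : 12 * a ≤ gap α) {x : Wien} (hx : ‖x‖ ≤ 1) :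
    |speedShift a x| ≤ gap α :=
  (abs_speedShift_le ha hx).trans (by linarith)

lemma norm_waveMap_le (hα : 0 < α) (ha : 0 ≤ a) (ha' : 12 * a ≤ gap α) {x : Wien}
    (hx : ‖x‖ ≤ 1) : ‖waveMap α a x‖ ≤ 9 * (1 / (2 * gap α)) * a := by
  have hκ := gap_pos hα
  rw [waveMap, norm_smul, Real.norm_of_nonneg ha]
  have h1 := norm_invOp_le hα (abs_speedShift_le_gap ha ha' hx) (sq x)
  have h2 : 1 / (2 * gap α) * ‖sq x‖ ≤ 1 / (2 * gap α) * 9 := by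
    gcongr
    exact norm_sq_le hx
  calc a * ‖invOp α (speedShift a x) (sq x)‖ ≤ a * (1 / (2 * gap α) * 9) := by
        gcongr
        exact h1.trans h2
    _ = _ := by ring

lemma norm_waveMap_sub_le (hα : 0 < α) (ha : 0 ≤ a) (ha' : 12 * a ≤ gap α) {x y : Wien}
    (hx : ‖x‖ ≤ 1) (hy : ‖y‖ ≤ 1) : ‖waveMap α a x - waveMap α a y‖ ≤ 1 / 2 * ‖x - y‖ := by
  have hκ := gap_pos hα
  have gx := abs_speedShift_le_gap ha ha' hx
  have gy := abs_speedShift_le_gap ha ha' hy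
  have h1 := norm_sq_sub_le hx hy
  have h2 : |speedShift a x - speedShift a y| ≤ a / 4 * (6 * ‖x - y‖) := by
    rw [speedShift, speedShift, ← mul_sub, abs_mul, abs_of_nonneg (by positivity : 0 ≤ a / 4)]
    gcongr
    exact (norm_apply_le (sq x - sq y) 1).trans h1
  have h3 : waveMap α a x - waveMap α a y = a • (invOp α (speedShift a x) (sq x - sq y)
      + (invOp α (speedShift a x) (sq y) - invOp α (speedShift a y) (sq y))) := by
    rw [waveMap, waveMap, ← smul_sub, map_sub]
    congr 1
    abel
  have h4 : ‖invOp α (speedShift a x) (sq x - sq y)‖ ≤ 1 / (2 * gap α) * (6 * ‖x - y‖) :=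
    (norm_invOp_le hα gx _).trans (by gcongr)
  have h5 : ‖invOp α (speedShift a x) (sq y) - invOp α (speedShift a y) (sq y)‖
      ≤ 1 / (2 * gap α ^ 2) * (a / 4 * (6 * ‖x - y‖)) * 9 :=
    (norm_invOp_sub_le hα gx gy _).trans (by
      gcongr
      exact norm_sq_le hy)
  rw [h3, norm_smul, Real.norm_of_nonneg ha]
  have h6 : a / gap α ≤ 1 / 12 := by
    rw [div_le_iff₀ hκ]
    linarith
  have h7 : 0 ≤ a / gap α := by positivity
  calc a * ‖_ + _‖ ≤ a * (1 / (2 * gap α) * (6 * ‖x - y‖)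
        + 1 / (2 * gap α ^ 2) * (a / 4 * (6 * ‖x - y‖)) * 9) := by
        gcongr
        exact (norm_add_le _ _).trans (add_le_add h4 h5)
    _ = (3 * (a / gap α) + 27 / 4 * (a / gap α) ^ 2) * ‖x - y‖ := by
        field_simp
        ring
    _ ≤ 1 / 2 * ‖x - y‖ := by
        gcongr
        nlinarith

lemma exists_fixedPoint (hα : 0 < α) (ha : 0 ≤ a) (ha' : 12 * a ≤ gap α) :
    ∃ x : Wien, ‖x‖ ≤ 1 ∧ refl x = x ∧ waveMap α a x = x := by
  have hκ := gap_pos hα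
  set s : Set Wien := Metric.closedBall 0 1 ∩ {x | refl x = x} with hs
  have hsc : IsComplete s :=
    (Metric.isClosed_closedBall.inter (isClosed_eq refl.continuous continuous_id)).isComplete
  have hmem : ∀ {x}, x ∈ s ↔ ‖x‖ ≤ 1 ∧ refl x = x := by
    intro x
    rw [hs, mem_inter_iff, mem_closedBall_zero_iff]
    rfl
  have hmaps : MapsTo (waveMap α a) s s := by
    intro x hx
    rw [hmem] at hx ⊢
    refine ⟨(norm_waveMap_le hα ha ha' hx.1).trans ?_, ?_⟩
    · rw [mul_one_div, div_mul_eq_mul_div, div_le_one (by positivity)]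
      linarith
    · rw [waveMap, map_smul, refl_invOp hα (abs_speedShift_le_gap ha ha' hx.1), refl_sq hx.2]
  have hcontr : ContractingWith (1 / 2) (hmaps.restrict (waveMap α a) s s) := by
    refine ⟨by norm_num, LipschitzWith.of_dist_le_mul fun x y => ?_⟩
    rw [Subtype.dist_eq, Subtype.dist_eq, dist_eq_norm, dist_eq_norm]
    simpa using norm_waveMap_sub_le hα ha ha' (hmem.1 x.2).1 (hmem.1 y.2).1
  obtain ⟨x, hx, hfix, -⟩ := hcontr.exists_fixedPoint' hsc hmaps
    (x := 0) (hmem.2 ⟨by simp, map_zero _⟩) (edist_ne_top _ _)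
  exact ⟨x, (hmem.1 hx).1, (hmem.1 hx).2, hfix⟩

lemma fixedPoint_apply (hα : 0 < α) (ha : 0 ≤ a) (ha' : 12 * a ≤ gap α) {x : Wien}
    (hx : ‖x‖ ≤ 1) (hfix : waveMap α a x = x) (k : ℤ) :
    x k = a * (invSymbol α (speedShift a x) k * sq x k) := by
  have h := congrArg (fun y : Wien => y k) hfix
  rw [← h]
  change a * invOp α (speedShift a x) (sq x) k = _
  rw [invOp_apply hα (abs_speedShift_le_gap ha ha' hx)]

lemma fixedPoint_apply_low (hα : 0 < α) (ha : 0 ≤ a) (ha' : 12 * a ≤ gap α) {x : Wien}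
    (hx : ‖x‖ ≤ 1) (hfix : waveMap α a x = x) {k : ℤ} (hk : ¬ 1 < |k|) : x k = 0 := by
  rw [fixedPoint_apply hα ha ha' hx hfix, invSymbol, high_of_not_lt _ hk, zero_mul, mul_zero]

lemma realSeries_smul (a : ℝ) (x : Wien) : realSeries (a • x) = a • realSeries x := by
  ext t
  change (series (a • x) t).re = a * (series x t).re
  rw [map_smul]
  change (a • series x t).re = _
  rw [Complex.real_smul, Complex.re_ofReal_mul]

lemma realSeries_sub (x y : Wien) : realSeries (x - y) = realSeries x - realSeries y := by
  ext t
  change (series (x - y) t).re = (series x t).re - (series y t).re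
  rw [map_sub]
  rfl

lemma cosSeq_apply (k : ℤ) : cosSeq k = (if k = 1 then 1 else 0) + if k = -1 then 1 else 0 := by
  rw [cosSeq, lp.coeFn_add, Pi.add_apply, unit_apply, unit_apply]

/-- A fixed point of `waveMap` is the sequence of a wave. -/
lemma isEvenWave_of_fixedPoint (hα : 0 < α) (ha : 0 ≤ a) (ha' : 12 * a ≤ gap α) {x : Wien}
    (hx : ‖x‖ ≤ 1) (hr : refl x = x) (hfix : waveMap α a x = x) :
    IsEvenWave α (1 / 2 + speedShift a x) (realSeries (a • (cosSeq + x))) := by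
  have hlow : ∀ {k : ℤ}, ¬ 1 < |k| → x k = 0 := fixedPoint_apply_low hα ha ha' hx hfix
  have hγ := abs_speedShift_le_gap ha ha' hx
  have hr1 : refl (cosSeq + x) = cosSeq + x := by rw [map_add, refl_cosSeq, hr]
  have hr2 : refl (a • (cosSeq + x)) = a • (cosSeq + x) := by rw [map_smul, hr1]
  have hsq : refl (sq x) = sq x := refl_sq hr
  have hmul : realSeries (a • (cosSeq + x)) * realSeries (a • (cosSeq + x))
      = realSeries ((a * a) • sq x) := by
    rw [realSeries_mul hr2 hr2, map_smul, map_smul, smul_apply, smul_smul, sq]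
  refine isEvenWave_of_coef (contDiff_realSeries _) (realSeries_even hr2) ?_ fun k hk => ?_
  · rw [coef_realSeries hr2]
    change ((2 ^ (-|(0 : ℤ)|) * (a * (cosSeq 0 + x 0)) : ℝ) : ℂ) = 0
    rw [cosSeq_apply, hlow (by simp)]
    simp
  · rw [hmul, coef_realSeries hr2, coef_realSeries (by rw [map_smul, hsq])]
    change _ * ((2 ^ (-|k|) * (a * (cosSeq k + x k)) : ℝ) : ℂ)
      = 1 / 2 * ((2 ^ (-|k|) * (a * a * sq x k) : ℝ) : ℂ)
    suffices h : ((1 / 2 + speedShift a x) * absPow α k + (1 / 2 + speedShift a x - 1))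
        * (2 ^ (-|k|) * (a * (cosSeq k + x k))) = 1 / 2 * (2 ^ (-|k|) * (a * a * sq x k)) by
      rw [← Complex.ofReal_mul, h]
      push_cast
      ring
    by_cases h1 : 1 < |k|
    · have h2 := fixedPoint_apply hα ha ha' hx hfix k
      have h3 : cosSeq k = 0 := by
        rw [cosSeq_apply, if_neg, if_neg, add_zero] <;>
        · rintro rfl
          simp at h1
      have h4 := gap_mul_le_symbol' hα hγ h1
      have h5 : 0 < gap α * (1 + absPow α k) :=
        mul_pos (gap_pos hα) (add_pos_of_pos_of_nonneg one_pos (absPow_nonneg α k))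
      rw [h3, zero_add, h2, invSymbol, high_of_lt _ h1]
      have h6 := (h5.trans_le h4).ne'
      generalize (1 / 2 + speedShift a x) * absPow α k + (1 / 2 + speedShift a x - 1) = A at h6 ⊢
      field_simp
    · have h2 : absPow α k = 1 ∧ cosSeq k = 1 ∧ sq x k = sq x 1 := by
        rcases eq_of_not_one_lt_abs h1 with rfl | rfl | rfl
        · refine ⟨by rw [absPow_neg, absPow_one], by simp [cosSeq_apply], ?_⟩
          rw [← refl_apply, hsq]
        · exact absurd rfl hk
        · exact ⟨absPow_one α, by simp [cosSeq_apply], rfl⟩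
      rw [h2.1, h2.2.1, h2.2.2, hlow h1, speedShift]
      ring

lemma coef_one_of_fixedPoint (hα : 0 < α) (ha : 0 ≤ a) (ha' : 12 * a ≤ gap α) {x : Wien}
    (hx : ‖x‖ ≤ 1) (hr : refl x = x) (hfix : waveMap α a x = x) :
    coef (realSeries (a • (cosSeq + x))) 1 = ((a / 2 : ℝ) : ℂ) := by
  have hr2 : refl (a • (cosSeq + x)) = a • (cosSeq + x) := by
    rw [map_smul, map_add, refl_cosSeq, hr]
  rw [coef_realSeries hr2]
  change ((2 ^ (-|(1 : ℤ)|) * (a * (cosSeq 1 + x 1)) : ℝ) : ℂ) = _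
  rw [cosSeq_apply, fixedPoint_apply_low hα ha ha' hx hfix (by simp)]
  congr 1
  simp
  ring

end Wave

/-! ### Expansion of the waves in the amplitude -/

section Expansion

lemma cosSeq_conv_apply (x : Wien) (k : ℤ) :
    conv cosSeq x k = weight 1 (k - 1) * x (k - 1) + weight (-1) (k + 1) * x (k + 1) := by
  rw [cosSeq, map_add, add_apply, lp.coeFn_add, Pi.add_apply, conv_unit_apply,
    conv_unit_apply, sub_neg_eq_add]

lemma sq_eq (x : Wien) : sq x = conv cosSeq cosSeq + (2 : ℝ) • conv cosSeq x + conv x x := by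
  rw [sq, map_add conv, add_apply, map_add, map_add, conv_comm x cosSeq, two_smul]
  abel

/-- The sequence of `cos (2t) / 2`. -/
def cosTwoSeq : Wien := unit 2 + unit (-2)

lemma cosTwoSeq_apply (k : ℤ) :
    cosTwoSeq k = (if k = 2 then 1 else 0) + if k = -2 then 1 else 0 := by
  rw [cosTwoSeq, lp.coeFn_add, Pi.add_apply, unit_apply, unit_apply]

lemma norm_cosTwoSeq_le : ‖cosTwoSeq‖ ≤ 2 := by
  refine (norm_add_le _ _).trans ?_
  rw [norm_unit, norm_unit]
  norm_num

lemma conv_cosSeq_cosSeq : conv cosSeq cosSeq = cosTwoSeq + (1 / 2 : ℝ) • unit 0 := by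
  have h : conv cosSeq cosSeq = conv (unit 1) (unit 1) + conv (unit 1) (unit (-1))
      + (conv (unit (-1)) (unit 1) + conv (unit (-1)) (unit (-1))) := by
    rw [cosSeq, map_add conv, add_apply, map_add, map_add]
  rw [h, conv_unit_unit, conv_unit_unit, conv_unit_unit, conv_unit_unit, cosTwoSeq, weight, weight,
    weight, weight]
  norm_num
  module

lemma conv_cosTwoSeq_self_apply_one : conv cosTwoSeq cosTwoSeq 1 = 0 := by
  nth_rewrite 1 [cosTwoSeq]
  rw [map_add, add_apply, lp.coeFn_add, Pi.add_apply, conv_unit_apply, conv_unit_apply,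
    cosTwoSeq_apply, cosTwoSeq_apply]
  norm_num

variable {α a : ℝ}

lemma invSymbol_two (γ : ℝ) :
    invSymbol α γ 2 = (2 * ((1 / 2 + γ) * 2 ^ α + (1 / 2 + γ - 1)))⁻¹ := by
  rw [invSymbol, high_of_lt _ (by norm_num), absPow]
  norm_num

lemma invSymbol_zero_two : invSymbol α 0 2 = (2 ^ α - 1)⁻¹ := by
  rw [invSymbol_two]
  congr 1
  ring

lemma invOp_conv_cosSeq (hα : 0 < α) {γ : ℝ} (hγ : |γ| ≤ gap α) :
    invOp α γ (conv cosSeq cosSeq) = invSymbol α γ 2 • cosTwoSeq := by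
  ext k
  rw [invOp_apply hα hγ, conv_cosSeq_cosSeq]
  change invSymbol α γ k * (cosTwoSeq k + 1 / 2 * unit 0 k) = invSymbol α γ 2 * cosTwoSeq k
  rw [unit_apply, cosTwoSeq_apply]
  by_cases h2 : k = 2
  · subst h2
    norm_num
  by_cases h3 : k = -2
  · subst h3
    have : invSymbol α γ (-2) = invSymbol α γ 2 := by
      rw [invSymbol, high, high, abs_neg, absPow_neg]
    rw [this]
    norm_num
  by_cases h0 : k = 0
  · subst h0
    rw [invSymbol, high_of_not_lt _ (by simp)]
    norm_num
  · simp [h0, h2, h3]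

lemma sub_smul_apply (x y : Wien) (s : ℝ) (k : ℤ) : (x - s • y) k = x k - s * y k := rfl

lemma sq_apply (x : Wien) (k : ℤ) :
    sq x k = cosTwoSeq k + 1 / 2 * unit 0 k + 2 * conv cosSeq x k + conv x x k := by
  rw [sq_eq, conv_cosSeq_cosSeq]
  rfl

lemma sq_apply_one {x : Wien} (h0 : x 0 = 0) : sq x 1 = 1 / 2 * x 2 + conv x x 1 := by
  have h1 : conv cosSeq x 1 = weight 1 0 * x 0 + weight (-1) 2 * x 2 := cosSeq_conv_apply x 1
  rw [sq_apply, h1, h0, cosTwoSeq_apply, unit_apply, weight, weight]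
  norm_num
  ring

lemma sq_apply_two {x : Wien} (h0 : x 1 = 0) : sq x 2 = 1 + 1 / 2 * x 3 + conv x x 2 := by
  have h1 : conv cosSeq x 2 = weight 1 1 * x 1 + weight (-1) 3 * x 3 := cosSeq_conv_apply x 2
  rw [sq_apply, h1, h0, cosTwoSeq_apply, unit_apply, weight, weight]
  norm_num
  ring

lemma abs_invSymbol_two_sub_le (hα : 0 < α) {γ : ℝ} (hγ : |γ| ≤ gap α) :
    |invSymbol α γ 2 - (2 ^ α - 1)⁻¹| ≤ 2 * (1 / (2 * gap α)) ^ 2 * |γ| := by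
  have hκ := gap_pos hα
  have h := abs_invSymbol_sub_le hα hγ (δ := 0) (by simpa using hκ.le) 2
  rw [invSymbol_zero_two, sub_zero] at h
  refine h.trans (le_of_eq ?_)
  field_simp

lemma abs_inv_le (hα : 0 < α) : |(2 ^ α - 1 : ℝ)⁻¹| ≤ 1 / (2 * gap α) := by
  rw [← invSymbol_zero_two]
  exact norm_invSymbol_le hα (by simpa using (gap_pos hα).le) 2

lemma norm_fixedPoint_le (hα : 0 < α) (ha : 0 ≤ a) (ha' : 12 * a ≤ gap α) {x : Wien}
    (hx : ‖x‖ ≤ 1) (hfix : waveMap α a x = x) : ‖x‖ ≤ 9 * (1 / (2 * gap α)) * a := by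
  have := norm_waveMap_le hα ha ha' hx
  rwa [hfix] at this

/-- A fixed point of `waveMap` to first order in `a`. -/
lemma norm_fixedPoint_sub_le (hα : 0 < α) (ha : 0 ≤ a) (ha' : 12 * a ≤ gap α) {x : Wien}
    (hx : ‖x‖ ≤ 1) (hfix : waveMap α a x = x) :
    ‖x - (a * (2 ^ α - 1)⁻¹) • cosTwoSeq‖ ≤ 54 * (1 / (2 * gap α)) ^ 2 * a ^ 2 := by
  have hκ := gap_pos hα
  have hγ := abs_speedShift_le_gap ha ha' hx
  have hxn := norm_fixedPoint_le hα ha ha' hx hfix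
  have hgg := abs_invSymbol_two_sub_le hα hγ
  have hγ1 := abs_speedShift_le ha hx
  have e1 : x - (a * (2 ^ α - 1)⁻¹) • cosTwoSeq
      = a • (invOp α (speedShift a x) ((2 : ℝ) • conv cosSeq x + conv x x)
      + (invSymbol α (speedShift a x) 2 - (2 ^ α - 1)⁻¹) • cosTwoSeq) := by
    nth_rewrite 1 [← hfix]
    rw [waveMap, sq_eq, add_assoc, map_add, invOp_conv_cosSeq hα hγ]
    module
  generalize speedShift a x = γ at *
  set h := 1 / (2 * gap α) with hh
  have h0 : 0 < h := by positivity
  have e2 : ‖(2 : ℝ) • conv cosSeq x + conv x x‖ ≤ 5 * ‖x‖ := by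
    refine (norm_add_le _ _).trans ?_
    rw [norm_smul, Real.norm_ofNat]
    have e3 := norm_conv_le cosSeq x
    have e4 := norm_conv_le x x
    have e5 : ‖cosSeq‖ * ‖x‖ ≤ 2 * ‖x‖ := by
      gcongr
      exact norm_cosSeq_le
    have e6 : ‖x‖ * ‖x‖ ≤ 1 * ‖x‖ := by gcongr
    linarith
  have e3 : ‖invOp α γ ((2 : ℝ) • conv cosSeq x + conv x x)‖ ≤ h * (5 * (9 * h * a)) :=
    (norm_invOp_le hα hγ _).trans (by
      gcongr
      exact e2.trans (by gcongr))
  have e4 : ‖(invSymbol α γ 2 - (2 ^ α - 1)⁻¹) • cosTwoSeq‖ ≤ 2 * h ^ 2 * (9 / 4 * a) * 2 := by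
    rw [norm_smul]
    refine mul_le_mul (hgg.trans ?_) norm_cosTwoSeq_le (norm_nonneg _) (by positivity)
    gcongr
  rw [e1, norm_smul, Real.norm_of_nonneg ha]
  calc a * ‖_ + _‖ ≤ a * (h * (5 * (9 * h * a)) + 2 * h ^ 2 * (9 / 4 * a) * 2) := by
        gcongr
        exact (norm_add_le _ _).trans (add_le_add e3 e4)
    _ = _ := by ring

/-- The frequency `1` of `v²` vanishes to second order in `a`, since `v` has only the
frequencies `±2` to first order. -/
lemma abs_conv_fixedPoint_one_le (hα : 0 < α) (ha : 0 ≤ a) (ha' : 12 * a ≤ gap α) {x : Wien}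
    (hx : ‖x‖ ≤ 1) (hfix : waveMap α a x = x) :
    |conv x x 1| ≤ 594 * (1 / (2 * gap α)) ^ 3 * a ^ 3 := by
  have hκ := gap_pos hα
  have hxn := norm_fixedPoint_le hα ha ha' hx hfix
  have hrn := norm_fixedPoint_sub_le hα ha ha' hx hfix
  have hg := abs_inv_le hα
  set h := 1 / (2 * gap α) with hh
  have h0 : 0 < h := by positivity
  set p := (a * (2 ^ α - 1)⁻¹) • cosTwoSeq with hp
  have hpn : ‖p‖ ≤ 2 * h * a := by
    rw [hp, norm_smul, norm_mul, Real.norm_of_nonneg ha, Real.norm_eq_abs]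
    calc a * |(2 ^ α - 1 : ℝ)⁻¹| * ‖cosTwoSeq‖ ≤ a * h * 2 := by
          gcongr
          exact norm_cosTwoSeq_le
      _ = _ := by ring
  have hpp : conv p p 1 = 0 := by
    rw [hp, map_smul, map_smul, smul_apply, lp.coeFn_smul, lp.coeFn_smul, Pi.smul_apply,
      Pi.smul_apply, conv_cosTwoSeq_self_apply_one, smul_zero, smul_zero]
  have e1 : conv x x = conv p p + (conv (x - p) x + conv p (x - p)) := by
    rw [map_sub conv, sub_apply, map_sub]
    abel
  have e2 := (norm_apply_le (conv (x - p) x) 1).trans (norm_conv_le _ x)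
  have e3 := (norm_apply_le (conv p (x - p)) 1).trans (norm_conv_le p _)
  rw [e1, lp.coeFn_add, Pi.add_apply, hpp, zero_add, lp.coeFn_add, Pi.add_apply]
  calc _ ≤ ‖x - p‖ * ‖x‖ + ‖p‖ * ‖x - p‖ := (abs_add_le _ _).trans (add_le_add e2 e3)
    _ ≤ (54 * h ^ 2 * a ^ 2) * (9 * h * a) + (2 * h * a) * (54 * h ^ 2 * a ^ 2) := by gcongr
    _ = _ := by ring

lemma abs_conv_fixedPoint_le (hα : 0 < α) (ha : 0 ≤ a) (ha' : 12 * a ≤ gap α) {x : Wien}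
    (hx : ‖x‖ ≤ 1) (hfix : waveMap α a x = x) (k : ℤ) :
    |conv x x k| ≤ 81 * (1 / (2 * gap α)) ^ 2 * a ^ 2 := by
  have hκ := gap_pos hα
  have hxn := norm_fixedPoint_le hα ha ha' hx hfix
  calc _ ≤ ‖x‖ * ‖x‖ := (norm_apply_le _ k).trans (norm_conv_le x x)
    _ ≤ (9 * (1 / (2 * gap α)) * a) * (9 * (1 / (2 * gap α)) * a) := by gcongr
    _ = _ := by ring

lemma abs_speedShift_fixedPoint_le (hα : 0 < α) (ha : 0 ≤ a) (ha' : 12 * a ≤ gap α) {x : Wien}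
    (hx : ‖x‖ ≤ 1) (hfix : waveMap α a x = x) :
    |speedShift a x| ≤ 2 * (1 / (2 * gap α)) * a ^ 2 := by
  have hκ := gap_pos hα
  have e1 := (norm_apply_le x 2).trans (norm_fixedPoint_le hα ha ha' hx hfix)
  have e2 := abs_conv_fixedPoint_le hα ha ha' hx hfix 1
  have hah : 24 * (a * (1 / (2 * gap α))) ≤ 1 := by
    rw [mul_one_div, ← mul_div_assoc, div_le_one (by positivity)]
    linarith
  rw [speedShift, sq_apply_one (fixedPoint_apply_low hα ha ha' hx hfix (by simp))]
  set h := 1 / (2 * gap α) with hh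
  have h0 : 0 < h := by positivity
  have e3 : 81 * h ^ 2 * a ^ 2 ≤ 81 / 24 * (h * a) := by
    nlinarith [mul_nonneg h0.le ha]
  rw [abs_mul, abs_of_nonneg (by positivity)]
  calc _ ≤ a / 4 * (1 / 2 * (9 * h * a) + 81 / 24 * (h * a)) := by
        gcongr
        refine (abs_add_le _ _).trans (add_le_add ?_ (e2.trans e3))
        rw [abs_mul, abs_of_pos one_half_pos]
        gcongr
    _ ≤ _ := by nlinarith [mul_nonneg h0.le (sq_nonneg a)]

lemma abs_fixedPoint_two_sub_le (hα : 0 < α) (ha : 0 ≤ a) (ha' : 12 * a ≤ gap α) {x : Wien}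
    (hx : ‖x‖ ≤ 1) (hfix : waveMap α a x = x) :
    |x 2 - a * (2 ^ α - 1)⁻¹| ≤ 112 * (1 / (2 * gap α)) ^ 3 * a ^ 3 := by
  have hκ := gap_pos hα
  have hγ := abs_speedShift_le_gap ha ha' hx
  have hγ3 := abs_speedShift_fixedPoint_le hα ha ha' hx hfix
  have hgg := abs_invSymbol_two_sub_le hα hγ
  have hgh : |invSymbol α (speedShift a x) 2| ≤ _ := norm_invSymbol_le hα hγ 2
  have hrn := norm_fixedPoint_sub_le hα ha ha' hx hfix
  have e2 := abs_conv_fixedPoint_le hα ha ha' hx hfix 2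
  have hx3 : |x 3| ≤ 54 * (1 / (2 * gap α)) ^ 2 * a ^ 2 := by
    refine le_trans (le_of_eq ?_) ((norm_apply_le _ 3).trans hrn)
    rw [sub_smul_apply, cosTwoSeq_apply]
    norm_num
  have e1 : x 2 - a * (2 ^ α - 1)⁻¹
      = a * (invSymbol α (speedShift a x) 2 * (1 / 2 * x 3 + conv x x 2)
        + (invSymbol α (speedShift a x) 2 - (2 ^ α - 1)⁻¹)) := by
    rw [fixedPoint_apply hα ha ha' hx hfix 2,
      sq_apply_two (fixedPoint_apply_low hα ha ha' hx hfix (by simp))]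
    ring
  generalize speedShift a x = γ at *
  set h := 1 / (2 * gap α) with hh
  have h0 : 0 < h := by positivity
  rw [e1, abs_mul, abs_of_nonneg ha]
  calc _ ≤ a * (h * (1 / 2 * (54 * h ^ 2 * a ^ 2) + 81 * h ^ 2 * a ^ 2)
        + 2 * h ^ 2 * (2 * h * a ^ 2)) := by
        gcongr
        refine (abs_add_le _ _).trans (add_le_add ?_ (hgg.trans (by gcongr)))
        rw [abs_mul]
        gcongr
        refine (abs_add_le _ _).trans (add_le_add ?_ e2)
        rw [abs_mul, abs_of_pos one_half_pos]
        gcongr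
    _ = _ := by ring

/-- The speed to third order in `a`. -/
lemma abs_speedShift_sub_le (hα : 0 < α) (ha : 0 ≤ a) (ha' : 12 * a ≤ gap α) {x : Wien}
    (hx : ‖x‖ ≤ 1) (hfix : waveMap α a x = x) :
    |speedShift a x - a ^ 2 / (8 * (2 ^ α - 1))| ≤ 163 * (1 / (2 * gap α)) ^ 3 * a ^ 4 := by
  have hκ := gap_pos hα
  have hx2 := abs_fixedPoint_two_sub_le hα ha ha' hx hfix
  have hc1 := abs_conv_fixedPoint_one_le hα ha ha' hx hfix
  have e1 : speedShift a x - a ^ 2 / (8 * (2 ^ α - 1))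
      = a / 4 * (1 / 2 * (x 2 - a * (2 ^ α - 1)⁻¹) + conv x x 1) := by
    rw [speedShift, sq_apply_one (fixedPoint_apply_low hα ha ha' hx hfix (by simp))]
    have : (2 ^ α - 1 : ℝ) ≠ 0 := by linarith [one_lt_two_rpow hα]
    field_simp
    ring
  set h := 1 / (2 * gap α) with hh
  have h0 : 0 < h := by positivity
  rw [e1, abs_mul, abs_of_nonneg (by positivity)]
  calc _ ≤ a / 4 * (1 / 2 * (112 * h ^ 3 * a ^ 3) + 594 * h ^ 3 * a ^ 3) := by
        gcongr
        refine (abs_add_le _ _).trans (add_le_add ?_ hc1)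
        rw [abs_mul, abs_of_pos one_half_pos]
        gcongr
    _ ≤ _ := by nlinarith [mul_nonneg (pow_nonneg h0.le 3) (pow_nonneg ha 4)]

end Expansion

/-- The waves of small amplitude exist, with the first terms of their expansion. -/
theorem exists_wave {α : ℝ} (hα : 0 < α) {a : ℝ} (ha : 0 ≤ a) (ha' : 12 * a ≤ gap α) :
    ∃ (φ : C(Circ, ℝ)) (c : ℝ), IsEvenWave α c φ ∧ coef φ 1 = ((a / 2 : ℝ) : ℂ) ∧ ‖φ‖ ≤ 3 * a ∧
      |c - 1 / 2| ≤ gap α ∧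
      (∀ x : ℝ, |φ (x : Circ) - (a * Real.cos x + a ^ 2 / (2 * (2 ^ α - 1)) * Real.cos (2 * x))|
        ≤ 54 * (1 / (2 * gap α)) ^ 2 * a ^ 3) ∧
      |c - (1 / 2 + a ^ 2 / (8 * (2 ^ α - 1)))| ≤ 163 * (1 / (2 * gap α)) ^ 3 * a ^ 4 := by
  obtain ⟨x, hx, hr, hfix⟩ := exists_fixedPoint hα ha ha'
  have h1 := norm_fixedPoint_sub_le hα ha ha' hx hfix
  have h2 := abs_speedShift_sub_le hα ha ha' hx hfix
  refine ⟨realSeries (a • (cosSeq + x)), 1 / 2 + speedShift a x,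
    isEvenWave_of_fixedPoint hα ha ha' hx hr hfix, coef_one_of_fixedPoint hα ha ha' hx hr hfix,
    ?_, ?_, fun t => ?_, ?_⟩
  · refine (norm_realSeries_le _).trans ?_
    rw [norm_smul, Real.norm_of_nonneg ha, mul_comm]
    gcongr
    exact norm_cosSeq_add_le hx
  · rw [add_sub_cancel_left]
    exact abs_speedShift_le_gap ha ha' hx
  · have e1 : (2 ^ α - 1 : ℝ) ≠ 0 := by linarith [one_lt_two_rpow hα]
    have e2 : realSeries cosSeq (t : Circ) = Real.cos t := by
      rw [cosSeq, realSeries_unit_add_unit_neg]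
      norm_num
    have e3 : realSeries cosTwoSeq (t : Circ) = 1 / 2 * Real.cos (2 * t) := by
      rw [cosTwoSeq, realSeries_unit_add_unit_neg]
      norm_num
    have e4 : a • (cosSeq + x) - a • (x - (a * (2 ^ α - 1)⁻¹) • cosTwoSeq)
        - (a * (a * (2 ^ α - 1)⁻¹)) • cosTwoSeq = a • cosSeq := by
      module
    have e5 := congrArg (fun y => realSeries y (t : Circ)) e4
    simp only [realSeries_sub, realSeries_smul, ContinuousMap.sub_apply, ContinuousMap.smul_apply,
      e2, e3, smul_eq_mul] at e5
    have e6 : realSeries (a • (cosSeq + x)) (t : Circ)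
        - (a * Real.cos t + a ^ 2 / (2 * (2 ^ α - 1)) * Real.cos (2 * t))
        = a * realSeries (x - (a * (2 ^ α - 1)⁻¹) • cosTwoSeq) (t : Circ) := by
      simp only [realSeries_sub, realSeries_smul, ContinuousMap.sub_apply,
        ContinuousMap.smul_apply, e3, smul_eq_mul]
      have e7 : a ^ 2 / (2 * (2 ^ α - 1)) = a * (a * (2 ^ α - 1)⁻¹) * (1 / 2) := by
        field_simp
      rw [e7]
      linear_combination e5
    rw [e6, abs_mul, abs_of_nonneg ha]
    calc _ ≤ a * (54 * (1 / (2 * gap α)) ^ 2 * a ^ 2) := by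
          gcongr
          exact (abs_realSeries_le _ _).trans h1
      _ = _ := by ring
  · rwa [add_sub_add_left_eq_sub]

end FBBM
end

theorem mainTheorem2 (α : ℝ) (hα₀ : 0 < α) (hα₂ : α ≤ 2) :
    ∃ (a₀ : ℝ) (φ : ℝ → C(FBBM.Circ, ℝ)) (c : ℝ → ℝ), 0 < a₀ ∧
      FBBM.IsSmallAmplitudeBranch α a₀ φ c ∧
      ∀ a ∈ Set.Ioo 0 a₀, FBBM.SpectrallyStable α (c a) (φ a) := by
  have hκ := FBBM.gap_pos hα₀
  have hκ1 := FBBM.gap_lt hα₀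
  set κ := FBBM.gap α with hκdef
  have hp : (0 : ℝ) < 2 ^ α - 1 := sub_pos.2 (FBBM.one_lt_two_rpow hα₀)
  set h := 1 / (2 * κ) with hh
  have h0 : 0 < h := by positivity
  -- `a² < 1 / (1304 h³ (2^α - 1))` makes the error in the speed smaller than its leading term
  set b := 1 / (1304 * h ^ 3 * (2 ^ α - 1)) with hb
  set a₀ := min (κ / 12) b with ha₀
  have ha₀κ : a₀ ≤ κ / 12 := min_le_left _ _
  have hwave : ∀ a ∈ Ioo 0 a₀, _ := fun a ha => FBBM.exists_wave hα₀ (a := a) ha.1.le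
    (by rw [← hκdef]; linarith [ha.2])
  choose! φ c hw hcoef hnorm hc hprof hspeed using hwave
  have hnorm' : ∀ a ∈ Ioo 0 a₀, ‖φ a‖ ≤ 1 / 2 * κ := fun a ha =>
    (hnorm a ha).trans (by linarith [ha.2])
  have hne : ∀ a ∈ Ioo 0 a₀, FBBM.coef (φ a) 1 ≠ 0 := by
    intro a ha
    rw [hcoef a ha]
    exact Complex.ofReal_ne_zero.2 (half_pos ha.1).ne'
  have hgt : ∀ a ∈ Ioo 0 a₀, 1 / 2 < c a := by
    intro a ha
    have e1 := (abs_le.1 (hspeed a ha)).1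
    have e2 : a ^ 2 < b := by
      have e3 : a < b := ha.2.trans_le (min_le_right _ _)
      nlinarith [ha.1, ha.2]
    have e3 : 163 * h ^ 3 * a ^ 4 < a ^ 2 / (8 * (2 ^ α - 1)) := by
      have e4 : 163 * h ^ 3 * b = 1 / (8 * (2 ^ α - 1)) := by
        rw [hb]
        field_simp
        norm_num
      have ha2 : 0 < a ^ 2 := pow_pos ha.1 2
      calc 163 * h ^ 3 * a ^ 4 = 163 * h ^ 3 * a ^ 2 * a ^ 2 := by ring
        _ < 163 * h ^ 3 * b * a ^ 2 := by gcongr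
        _ = _ := by
          rw [e4]
          ring
    linarith
  refine ⟨a₀, φ, c, by positivity, ⟨hw, hgt, ⟨_, hprof⟩, ⟨_, hspeed⟩, ?_⟩, fun a ha =>
    (hw a ha).spectrallyStable hα₀ (hc a ha) (hgt a ha).le (hnorm' a ha) (hne a ha)⟩
  refine ⟨a₀ / 2, by positivity, fun c' ψ hψ hψ0 hψn hc' => ?_⟩
  have hc'κ : |c' - 1 / 2| ≤ κ := by linarith
  have hψκ : ‖ψ‖ ≤ 1 / 2 * κ := by linarith
  have hψ1 := hψ.coef_one_ne_zero hα₀ hc'κ (by linarith) hψ0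
  obtain ⟨p, hp⟩ := Complex.conj_eq_iff_real.1 (FBBM.conj_coef_of_even hψ.even 1)
  have hpn : |p| ≤ ‖ψ‖ := by
    have := FBBM.norm_coef_le ψ 1
    rwa [hp, Complex.norm_real] at this
  have hp0 : p ≠ 0 := by
    rintro rfl
    exact hψ1 (by rw [hp, Complex.ofReal_zero])
  rcases lt_or_gt_of_ne hp0 with hneg | hpos
  · have ha : -(2 * p) ∈ Ioo 0 a₀ := ⟨by linarith, by rw [abs_of_neg hneg] at hpn; linarith⟩
    have h1 : FBBM.coef (FBBM.halfShift ψ) 1 = FBBM.coef (φ (-(2 * p))) 1 := by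
      rw [FBBM.coef_one_halfShift, hcoef _ ha, hp, ← Complex.ofReal_neg]
      congr 1
      ring
    obtain ⟨h2, h3⟩ := hψ.halfShift.eq_of_coef_one_eq hα₀ (hw _ ha) hc'κ (hc _ ha)
      ((FBBM.norm_halfShift_le ψ).trans hψκ) (hnorm' _ ha) h1 (hne _ ha)
    refine ⟨_, ha, h2, Or.inr fun x => ?_⟩
    rw [← h3, ← FBBM.halfShift_apply, FBBM.halfShift_halfShift]
  · have ha : 2 * p ∈ Ioo 0 a₀ := ⟨by linarith, by rw [abs_of_pos hpos] at hpn; linarith⟩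
    have h1 : FBBM.coef ψ 1 = FBBM.coef (φ (2 * p)) 1 := by
      rw [hcoef _ ha, hp]
      congr 1
      ring
    obtain ⟨h2, h3⟩ := hψ.eq_of_coef_one_eq hα₀ (hw _ ha) hc'κ (hc _ ha) hψκ (hnorm' _ ha) h1
      (hne _ ha)
    exact ⟨_, ha, h2, Or.inl fun x => by rw [h3]⟩
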